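/- Let $\{X_t\}_{t\ge 1}$ be a time-homogeneous Markov chain on a measurable space $\mathcal X$ (with arbitrary initial law), let $\tilde A:\mathcal X\to\mathbb R^{d\times d}$ and $\tilde b:\mathcal X\to\mathbb R^d$ be measurable, and assume the following. (A1) The chain is uniformly ergodic with unique stationary distribution $\mu$: its transition kernel $\mathcal P$ satisfies $\sup_{x\in\mathcal X}\|\mathcal P^t(x,\cdot)-\mu\|_{TV}\to 0$ as $t\to\infty$. (A2) There are a matrix $\bar A$ and a vector $\bar b$ with $\bar A=\lim_{t\to\infty}\mathbb E[\tilde A(X_t)]$ and $\bar b=\lim_{t\to\infty}\mathbb E[\tilde b(X_t)]$; the matrix $\bar A$ is of full rank and Hurwitz (all its eigenvalues have strictly negative real parts); and $\sup_{x}\|\tilde A(x)\|_F\le A_{\max}<\infty$, $\sup_{x}\|\tilde b(x)\|_2\le b_{\max}<\infty$. (A3) The step sizes are $\alpha_t=\alpha_0/t^{\eta}$, $t\ge 1$, with $\alpha_0>0$ and $\eta\in(1/2,1)$. Let $\{W_t\}_{t\ge 1}$ be i.i.d. real random variables, independent of the chain $\{X_t\}_{t\ge1}$, with mean $1$ and variance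 $1$ and with $|W_1|\le W_{\max}$ a.s. for a finite constant $W_{\max}$. Let $\theta_*$ be the unique solution of $\bar A\theta=\bar b$, and let the perturbed (bootstrap) iterates be defined, from an arbitrary (possibly random) initial value $\hat\theta_0\in\mathbb R^d$, by $$\hat\theta_{t+1}=\hat\theta_t+\alpha_{t+1}W_{t+1}\bigl(\tilde A(X_{t+1})\hat\theta_t-\tilde b(X_{t+1})\bigr),\qquad t\ge 0.$$ Then for every $\gamma\in(0,\eta-1/2)$, almost surely, $\|\hat\theta_t-\theta_*\|_2=o(t^{-\gamma})$ as $t\to\infty$. -/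

import Mathlib

open MeasureTheory ProbabilityTheory Filter Topology Asymptotics
open scoped Matrix Matrix.Norms.Frobenius

/-- `(Y 0, Y 1, Y 2, …)` is a time-homogeneous Markov chain with transition kernel `κ` (and
arbitrary initial law) under `P`: given the past `σ(Y 0, …, Y n)`, the conditional law of `Y (n+1)`
is `κ (Y n)`. -/
def IsMarkovChain {Ω S : Type*} [MeasurableSpace Ω] [MeasurableSpace S]
    (P : Measure Ω) (κ : Kernel S S) (Y : ℕ → Ω → S) : Prop :=
  (∀ n, Measurable (Y n)) ∧
    ∀ (n : ℕ) (B : Set S), MeasurableSet B →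
      P⟦Y (n + 1) ⁻¹' B | ⨆ i ≤ n, MeasurableSpace.comap (Y i) inferInstance⟧
        =ᵐ[P] fun ω => (κ (Y n ω)).real B

/-- The transition kernel `κ` is uniformly ergodic with unique stationary distribution `μ`:
the `n`-step transition probabilities `(κ ^ n) x` converge to `μ` in total variation, uniformly in
the initial state `x`. -/
structure IsUniformlyErgodic {S : Type*} [MeasurableSpace S]
    (κ : Kernel S S) (μ : Measure S) : Prop where
  stationary : Kernel.Invariant κ μ
  unique : ∀ ν : Measure S, IsProbabilityMeasure ν → Kernel.Invariant κ ν → ν = μ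
  tendsto : ∀ ε : ℝ, 0 < ε → ∃ N : ℕ, ∀ n, N ≤ n → ∀ (x : S) (B : Set S), MeasurableSet B →
    |((κ ^ n) x).real B - μ.real B| ≤ ε

/-- A real square matrix is Hurwitz if all its (complex) eigenvalues have negative real part. -/
def IsHurwitz {d : ℕ} (M : Matrix (Fin d) (Fin d) ℝ) : Prop :=
  ∀ z ∈ spectrum ℂ (M.map (algebraMap ℝ ℂ)), z.re < 0

/-- Polynomially decaying step sizes `α_t = α₀ / t ^ η`, for `t ≥ 1`. -/
noncomputable def stepSize (α₀ η : ℝ) (t : ℕ) : ℝ := α₀ / (t : ℝ) ^ η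

/-- The perturbed linear stochastic approximation iterates along one trajectory `x 1, x 2, …` of
observations and one sequence of weights `w 1, w 2, …`, started at `θ₀`:
`θ_{t+1} = θ_t + α_{t+1} w_{t+1} (A(x_{t+1}) θ_t - b(x_{t+1}))`.
The values `α 0`, `x 0` and `w 0` are not used. -/
noncomputable def perturbedIterate {S : Type*} {d : ℕ}
    (A : S → Matrix (Fin d) (Fin d) ℝ) (b : S → EuclideanSpace ℝ (Fin d))
    (α : ℕ → ℝ) (x : ℕ → S) (w : ℕ → ℝ) (θ₀ : EuclideanSpace ℝ (Fin d)) :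
    ℕ → EuclideanSpace ℝ (Fin d)
  | 0 => θ₀
  | t + 1 =>
      perturbedIterate A b α x w θ₀ t + (α (t + 1) * w (t + 1)) •
        (Matrix.toEuclideanLin (A (x (t + 1))) (perturbedIterate A b α x w θ₀ t) - b (x (t + 1)))

/-! The argument is pathwise once the noise series are controlled. The error D = θ - θ* satisfies
D_{n+1} = D_n + a_n (M_n D_n + ξ_n), where M_n = W A(X) has stationary mean Ā and ξ_n = W (A(X) θ* -
b(X)) has stationary mean Ā θ* - b̄ = 0. Suppose that Σ a_n (M_n - Ā) and Σ a_n ξ_n converge with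
tails R_n, Z_n = o(n^(-γ)). Then the corrected error y_n = D_n + R_n D_n + Z_n follows y_{n+1} = y_n
+ a_n Ā y_n + a_n · (small): the tails telescope the noise away. As Ā is Hurwitz, an equivalent norm
contracts under 1 + a Ā at rate 1 - c a, and n^(-γ) varies too slowly to spoil this, because 1/n =
o(a_n) when η < 1. So y, and with it D, is o(n^(-γ)); no a priori bound on the iterates is needed
(`isLittleO_of_linear_recursion`).

Probability enters only through the tails (`IsMarkovChain.ae_exists_tail_isLittleO`). By Abel
summation it is enough that the series with weights a_n n^γ converge almost surely, and these
weights are square summable because γ < η - 1/2. Split W f(X) - μ(f) as (W - 1) f(X) + (f(X) -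
μ(f)). The first term is a martingale difference once the whole chain is put into the past. The
second is, by the Poisson equation of the uniformly ergodic chain, a martingale difference plus a
telescoping term. Square summable weights handle the martingales, monotone weights tending to zero
the telescoping sum. -/

/-! ### Scalar contraction recursions -/

theorem tendsto_zero_of_le_contraction {u a e : ℕ → ℝ} {c : ℝ} (hc : 0 < c)
    (hu : ∀ n, 0 ≤ u n) (ha : ∀ n, 0 ≤ a n) (ha0 : Tendsto a atTop (𝓝 0))
    (hasum : Tendsto (fun n => ∑ i ∈ Finset.range n, a i) atTop atTop)
    (he : Tendsto e atTop (𝓝 0))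
    (h : ∀ᶠ n in atTop, u (n + 1) ≤ (1 - c * a n) * u n + a n * e n) :
    Tendsto u atTop (𝓝 0) := by
  rw [Metric.tendsto_atTop]
  intro ε hε
  have h1 : ∀ᶠ n in atTop, c * a n ≤ 1 := by
    have : Tendsto (fun n => c * a n) atTop (𝓝 0) := by simpa using ha0.const_mul c
    exact (this.eventually_lt_const one_pos).mono fun n hn => hn.le
  have h2 : ∀ᶠ n in atTop, e n ≤ c * (ε / 2) :=
    (he.eventually_lt_const (by positivity)).mono fun n hn => hn.le
  obtain ⟨N, hN⟩ := eventually_atTop.1 (h.and (h1.and h2))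
  set s : ℕ → ℝ := fun n => ∑ i ∈ Finset.range n, a i with hs
  -- ε / 2 is the fixed point of the recursion with `e n` replaced by its bound c ε / 2; the excess
  -- over it decays like the product of the factors 1 - c a ≤ exp(-c a).
  have key : ∀ n, N ≤ n → u n ≤ ε / 2 + u N * Real.exp (-(c * (s n - s N))) := by
    intro n hn
    induction n, hn using Nat.le_induction with
    | base => simp; linarith
    | succ n hn ih =>
      obtain ⟨i1, i2, i3⟩ := hN n hn
      have hsn : s (n + 1) = s n + a n := Finset.sum_range_succ _ _
      have hexp : (1 - c * a n) * Real.exp (-(c * (s n - s N)))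
          ≤ Real.exp (-(c * (s (n + 1) - s N))) := by
        have : -(c * (s (n + 1) - s N)) = -(c * a n) + -(c * (s n - s N)) := by rw [hsn]; ring
        rw [this, Real.exp_add]
        gcongr
        exact Real.one_sub_le_exp_neg _
      calc u (n + 1) ≤ (1 - c * a n) * u n + a n * e n := i1
        _ ≤ (1 - c * a n) * (ε / 2 + u N * Real.exp (-(c * (s n - s N)))) + a n * (c * (ε / 2)) := by
            have := ha n
            gcongr
        _ = ε / 2 + u N * ((1 - c * a n) * Real.exp (-(c * (s n - s N)))) := by ring
        _ ≤ _ := by gcongr; exact hu N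
  have hlim : Tendsto (fun n => u N * Real.exp (-(c * (s n - s N)))) atTop (𝓝 0) := by
    have : Tendsto (fun n => c * (s n - s N)) atTop atTop :=
      Tendsto.const_mul_atTop hc (tendsto_atTop_add_const_right _ _ hasum)
    simpa using (Real.tendsto_exp_neg_atTop_nhds_zero.comp this).const_mul (u N)
  obtain ⟨N', hN'⟩ := eventually_atTop.1 (hlim.eventually_lt_const (half_pos hε))
  refine ⟨max N N', fun n hn => ?_⟩
  rw [Real.dist_eq, sub_zero, abs_of_nonneg (hu n)]
  have := key n ((le_max_left _ _).trans hn)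
  have := hN' n ((le_max_right _ _).trans hn)
  linarith

/-- Dividing by `p` reduces this to the previous lemma: passing from `p n` to `p (n + 1)` costs a
factor 1 + δ, and since δ = o(a) this costs at most half of the contraction rate. -/
theorem isLittleO_of_le_contraction {x a e p δ : ℕ → ℝ} {c : ℝ} (hc : 0 < c)
    (hx : ∀ n, 0 ≤ x n) (ha : ∀ n, 0 < a n) (ha0 : Tendsto a atTop (𝓝 0))
    (hasum : Tendsto (fun n => ∑ i ∈ Finset.range n, a i) atTop atTop)
    (hp : ∀ n, 0 < p n) (hδ : ∀ n, 0 ≤ δ n) (hδa : δ =o[atTop] a)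
    (hpδ : ∀ n, p n ≤ (1 + δ n) * p (n + 1))
    (he : e =o[atTop] p)
    (h : ∀ᶠ n in atTop, x (n + 1) ≤ (1 - c * a n) * x n + a n * e n) :
    x =o[atTop] p := by
  have hδ0 : Tendsto δ atTop (𝓝 0) := hδa.isBigO.trans_tendsto ha0
  have he' := he.tendsto_div_nhds_zero
  rw [isLittleO_iff_tendsto fun n hn => absurd hn (hp n).ne']
  refine tendsto_zero_of_le_contraction (u := fun n => x n / p n) (a := a)
    (e := fun n => 2 * |e n / p n|) (half_pos hc) (fun n => div_nonneg (hx n) (hp n).le)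
    (fun n => (ha n).le) ha0 hasum (by simpa using (he'.abs).const_mul 2) ?_
  have h1 : ∀ᶠ n in atTop, c * a n ≤ 1 := by
    have : Tendsto (fun n => c * a n) atTop (𝓝 0) := by simpa using ha0.const_mul c
    exact (this.eventually_lt_const one_pos).mono fun n hn => hn.le
  filter_upwards [h, h1, hδa.bound (half_pos hc), hδ0.eventually_lt_const one_pos] with n i1 i2 i3 i4
  rw [Real.norm_of_nonneg (hδ n), Real.norm_of_nonneg (ha n).le] at i3
  have hr : 1 / p (n + 1) ≤ (1 + δ n) / p n := by
    rw [div_le_div_iff₀ (hp _) (hp _), one_mul]; exact hpδ n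
  have hq : 0 < p n := hp n
  calc x (n + 1) / p (n + 1) ≤ ((1 - c * a n) * x n + a n * |e n|) * (1 / p (n + 1)) := by
        rw [div_eq_mul_one_div]
        have := (hp (n + 1)).le
        gcongr
        refine i1.trans ?_
        have := ha n
        gcongr
        exact le_abs_self _
    _ ≤ ((1 - c * a n) * x n + a n * |e n|) * ((1 + δ n) / p n) := by
        have : 0 ≤ (1 - c * a n) * x n + a n * |e n| :=
          add_nonneg (mul_nonneg (by linarith) (hx n)) (mul_nonneg (ha n).le (abs_nonneg _))
        gcongr
    _ = ((1 - c * a n) * (1 + δ n)) * (x n / p n) + a n * ((1 + δ n) * |e n / p n|) := by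
        rw [abs_div, abs_of_pos hq]; ring
    _ ≤ (1 - c / 2 * a n) * (x n / p n) + a n * (2 * |e n / p n|) := by
        have h3 := ha n
        have h4 := div_nonneg (hx n) hq.le
        have h5 : (1 - c * a n) * (1 + δ n) ≤ 1 - c / 2 * a n := by
          nlinarith [mul_nonneg (mul_nonneg hc.le h3.le) (hδ n)]
        gcongr
        linarith

/-! ### Adapted norms and noisy linear recursions -/

/-- If `1 + α₀ T` has a power of norm less than one, then there is an equivalent norm for which
`1 + α T` is a contraction with rate `1 - c α` for all small `α`. -/
theorem exists_seminorm_contraction {E : Type*} [NormedAddCommGroup E] [NormedSpace ℝ E]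
    (T : E →L[ℝ] E) {α₀ : ℝ} (hα₀ : 0 < α₀) {N : ℕ} (hN0 : N ≠ 0)
    (hN : ‖(1 + α₀ • T) ^ N‖ < 1) :
    ∃ (q : Seminorm ℝ E) (C c : ℝ), 0 < C ∧ 0 < c ∧ (∀ x, ‖x‖ ≤ q x) ∧ (∀ x, q x ≤ C * ‖x‖) ∧
      ∀ α, 0 ≤ α → α ≤ α₀ → ∀ x, q (x + α • T x) ≤ (1 - c * α) * q x := by
  set B : E →L[ℝ] E := 1 + α₀ • T with hB
  obtain ⟨r, hr0, hr1, hr⟩ : ∃ r : ℝ, 0 < r ∧ r < 1 ∧ ‖B ^ N‖ ≤ r ^ N := by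
    have hcont : Tendsto (fun r : ℝ => r ^ N) (𝓝[<] 1) (𝓝 1) := by
      have : Tendsto (fun r : ℝ => r ^ N) (𝓝 1) (𝓝 (1 ^ N)) := (continuous_pow N).tendsto 1
      rw [one_pow] at this
      exact this.mono_left nhdsWithin_le_nhds
    have h1 := hcont.eventually_const_lt hN
    have h2 : ∀ᶠ r : ℝ in 𝓝[<] 1, 0 < r :=
      (eventually_gt_nhds one_pos).filter_mono nhdsWithin_le_nhds
    obtain ⟨r, h3, h4, h5⟩ := (h1.and (h2.and self_mem_nhdsWithin)).exists
    exact ⟨r, h4, h5, h3.le⟩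
  -- The adapted norm is Σ_{k<N} r^(-k) ‖B^k x‖. Applying `B` shifts the sum, each shifted term
  -- gaining a factor r; the new last term is at most r ‖x‖ because ‖B^N‖ ≤ r^N.
  let q : Seminorm ℝ E := ∑ k ∈ Finset.range N,
    (r⁻¹ ^ k).toNNReal • (normSeminorm ℝ E).comp ((B ^ k : E →L[ℝ] E) : E →ₗ[ℝ] E)
  have hq : ∀ x, q x = ∑ k ∈ Finset.range N, r⁻¹ ^ k * ‖(B ^ k) x‖ := by
    intro x
    have h1 : ∀ s : Finset ℕ, (∑ k ∈ s, (r⁻¹ ^ k).toNNReal •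
        (normSeminorm ℝ E).comp ((B ^ k : E →L[ℝ] E) : E →ₗ[ℝ] E)) x
        = ∑ k ∈ s, r⁻¹ ^ k * ‖(B ^ k) x‖ := by
      intro s
      induction s using Finset.induction_on with
      | empty => simp
      | insert k s hk ih =>
        rw [Finset.sum_insert hk, Finset.sum_insert hk, add_apply, ih]
        congr 1
        change ((r⁻¹ ^ k).toNNReal : ℝ) * ‖(B ^ k) x‖ = _
        rw [Real.coe_toNNReal _ (by positivity)]
    exact h1 _
  have hqB : ∀ x, q (B x) ≤ r * q x := by
    intro x
    obtain ⟨m, rfl⟩ := Nat.exists_eq_succ_of_ne_zero hN0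
    rw [hq, hq, Finset.sum_range_succ, Finset.sum_range_succ', mul_add, Finset.mul_sum]
    have e1 : ∀ k, (B ^ k) (B x) = (B ^ (k + 1)) x := fun k => by rw [pow_succ]; rfl
    refine add_le_add (Finset.sum_le_sum fun k _ => ?_) ?_
    · rw [e1, pow_succ r⁻¹, mul_comm (r⁻¹ ^ k) r⁻¹, mul_assoc, mul_inv_cancel_left₀ hr0.ne']
    · rw [e1]
      have : ‖(B ^ (m + 1)) x‖ ≤ r ^ (m + 1) * ‖x‖ :=
        ((B ^ (m + 1)).le_opNorm x).trans (by gcongr)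
      calc r⁻¹ ^ m * ‖(B ^ (m + 1)) x‖ ≤ r⁻¹ ^ m * (r ^ (m + 1) * ‖x‖) := by gcongr
        _ = r * ‖x‖ := by rw [inv_pow]; field_simp; ring
        _ = _ := by simp
  refine ⟨q, ∑ k ∈ Finset.range N, r⁻¹ ^ k * ‖B ^ k‖ + 1, (1 - r) / α₀, by positivity,
    div_pos (by linarith) hα₀, fun x => ?_, fun x => ?_, fun α h0 h1 x => ?_⟩
  · rw [hq]
    have := Finset.single_le_sum (f := fun k => r⁻¹ ^ k * ‖(B ^ k) x‖) (s := Finset.range N)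
      (fun k _ => by positivity) (Finset.mem_range.2 (Nat.pos_of_ne_zero hN0))
    simpa using this
  · rw [hq, add_mul, Finset.sum_mul]
    have : ∑ k ∈ Finset.range N, r⁻¹ ^ k * ‖(B ^ k) x‖
        ≤ ∑ k ∈ Finset.range N, r⁻¹ ^ k * ‖B ^ k‖ * ‖x‖ := by
      refine Finset.sum_le_sum fun k _ => ?_
      rw [mul_assoc]
      gcongr
      exact (B ^ k).le_opNorm x
    have := norm_nonneg x
    linarith
  -- For α ≤ α₀ this is a convex combination of x and B x, so the contraction by r at α₀
  -- interpolates linearly; hence c = (1 - r) / α₀.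
  · have hx : x + α • T x = (1 - α / α₀) • x + (α / α₀) • B x := by
      simp only [hB, add_apply, one_apply_eq_self,
        smul_apply, smul_add, smul_smul, sub_smul, one_smul,
        div_mul_cancel₀ α hα₀.ne']
      abel
    have h2 : α / α₀ ≤ 1 := (div_le_one hα₀).2 h1
    have h3 : 0 ≤ α / α₀ := by positivity
    rw [hx]
    refine (map_add_le_add q _ _).trans ?_
    rw [map_smul_eq_mul, map_smul_eq_mul, Real.norm_of_nonneg h3,
      Real.norm_of_nonneg (by linarith : 0 ≤ 1 - α / α₀)]
    calc (1 - α / α₀) * q x + α / α₀ * q (B x) ≤ (1 - α / α₀) * q x + α / α₀ * (r * q x) := by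
          gcongr; exact hqB x
      _ = _ := by field_simp; ring

/-- A linear recursion with multiplicative and additive noise, whose weighted noise series have
tails `R`, `Z` of order `o(p)`, is itself of order `o(p)`. -/
theorem isLittleO_of_linear_recursion {E : Type*} [NormedAddCommGroup E] [NormedSpace ℝ E]
    {D ξ Z : ℕ → E} {M R : ℕ → E →L[ℝ] E} {T : E →L[ℝ] E} {a p δ : ℕ → ℝ} {K : ℝ}
    (hD : ∀ n, D (n + 1) = D n + a n • (M n (D n) + ξ n))
    (hM : ∀ n, ‖M n‖ ≤ K) (hξ : ∀ n, ‖ξ n‖ ≤ K)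
    (hR : ∀ n, R n - R (n + 1) = a n • (M n - T)) (hZ : ∀ n, Z n - Z (n + 1) = a n • ξ n)
    (hRp : R =o[atTop] p) (hZp : Z =o[atTop] p)
    (ha : ∀ n, 0 < a n) (ha0 : Tendsto a atTop (𝓝 0))
    (hasum : Tendsto (fun n => ∑ i ∈ Finset.range n, a i) atTop atTop)
    (hp : ∀ n, 0 < p n) (hδ : ∀ n, 0 ≤ δ n) (hδa : δ =o[atTop] a)
    (hpδ : ∀ n, p n ≤ (1 + δ n) * p (n + 1)) (hanti : Antitone p)
    (q : Seminorm ℝ E) {C c α₀ : ℝ} (hC : 0 < C) (hc : 0 < c) (hα₀ : 0 < α₀)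
    (hq1 : ∀ x, ‖x‖ ≤ q x) (hq2 : ∀ x, q x ≤ C * ‖x‖)
    (hq : ∀ α, 0 ≤ α → α ≤ α₀ → ∀ x, q (x + α • T x) ≤ (1 - c * α) * q x) :
    D =o[atTop] p := by
  have hp1 : p =O[atTop] (fun _ => (1 : ℝ)) := by
    refine IsBigO.of_bound (p 0) (Eventually.of_forall fun n => ?_)
    rw [Real.norm_of_nonneg (hp n).le]; simpa using hanti (Nat.zero_le n)
  have hR0 : Tendsto (fun n => ‖R n‖) atTop (𝓝 0) := by
    simpa using (isLittleO_one_iff ℝ).1 (hRp.trans_isBigO hp1) |>.norm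
  have hR0' : Tendsto (fun n => ‖R (n + 1)‖) atTop (𝓝 0) := hR0.comp (tendsto_add_atTop_nat 1)
  have hRp' : (fun n => R (n + 1)) =o[atTop] p := by
    refine (hRp.comp_tendsto (tendsto_add_atTop_nat 1)).trans_isBigO ?_
    refine IsBigO.of_bound 1 (Eventually.of_forall fun n => ?_)
    simp only [Function.comp, Real.norm_of_nonneg (hp _).le, one_mul]
    exact hanti (Nat.le_succ n)
  have hK : 0 ≤ K := (norm_nonneg _).trans (hM 0)
  -- The corrector: its increments cancel a (M - T) D and a ξ, leaving drift T and errors that carry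
  -- a factor `R` or `Z`.
  set y : ℕ → E := fun n => D n + R n (D n) + Z n with hy
  set s : ℕ → ℝ := fun n => 2 * (‖T‖ * ‖R n‖ + K * ‖R (n + 1)‖) with hs
  set e : ℕ → ℝ := fun n => s n * ‖Z n‖ + ‖T‖ * ‖Z n‖ + K * ‖R (n + 1)‖ with he
  have hs0 : Tendsto s atTop (𝓝 0) := by
    simpa using (((hR0.const_mul ‖T‖).add (hR0'.const_mul K)).const_mul 2)
  have hep : e =o[atTop] p := by
    refine (IsLittleO.add (IsLittleO.add ?_ (hZp.norm_left.const_mul_left _))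
      (hRp'.norm_left.const_mul_left _))
    have h1 : s =O[atTop] (fun _ => (1 : ℝ)) := hs0.isBigO_one ℝ
    simpa using h1.mul_isLittleO hZp.norm_left
  -- Once ‖R n‖ < 1/2, the map 1 + R n can be inverted with loss 2, so D is controlled by y and Z.
  have hDy : ∀ᶠ n in atTop, ‖D n‖ ≤ 2 * (‖y n‖ + ‖Z n‖) := by
    filter_upwards [hR0.eventually_lt_const (by norm_num : (0 : ℝ) < 1 / 2)] with n hn
    have h1 : D n = y n - R n (D n) - Z n := by simp only [hy]; abel
    have h2 : ‖D n‖ ≤ ‖y n‖ + ‖R n (D n)‖ + ‖Z n‖ := by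
      conv_lhs => rw [h1]
      exact (norm_sub_le _ _).trans (by gcongr; exact norm_sub_le _ _)
    have h3 : ‖R n (D n)‖ ≤ 1 / 2 * ‖D n‖ := ((R n).le_opNorm _).trans (by gcongr)
    linarith
  have hstep : ∀ n, y (n + 1) = (y n + a n • T (y n))
      + a n • (R (n + 1) (M n (D n) + ξ n) - T (R n (D n)) - T (Z n)) := by
    intro n
    have h1 : Z (n + 1) = Z n - a n • ξ n := by rw [← hZ n]; abel
    have h2 : R (n + 1) (D n) = R n (D n) - a n • (M n (D n) - T (D n)) := by
      have := congrArg (fun L : E →L[ℝ] E => L (D n)) (hR n)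
      simp only [sub_apply, smul_apply] at this
      rw [← this]; abel
    have h3 : R (n + 1) (D (n + 1)) = R (n + 1) (D n) + a n • R (n + 1) (M n (D n) + ξ n) := by
      rw [hD n, map_add, map_smul]
    simp only [hy]
    rw [h3, h2, h1, hD n]
    simp only [map_add, smul_add, smul_sub]
    abel
  have hqy : (fun n => q (y n)) =o[atTop] p := by
    refine isLittleO_of_le_contraction (e := fun n => C * e n) (half_pos hc)
      (fun n => apply_nonneg q _) ha ha0 hasum hp hδ hδa hpδ (hep.const_mul_left C) ?_
    have hCs : Tendsto (fun n => C * s n) atTop (𝓝 0) := by simpa using hs0.const_mul C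
    filter_upwards [hDy, ha0.eventually_lt_const hα₀, hCs.eventually_lt_const (half_pos hc)]
      with n i1 i2 i3
    -- The part s ‖y‖ with s → 0 will be absorbed into half of the contraction rate; `e` is o(p) and
    -- acts as forcing.
    have hb : ‖R (n + 1) (M n (D n) + ξ n) - T (R n (D n)) - T (Z n)‖ ≤ s n * ‖y n‖ + e n := by
      have j1 : ‖R (n + 1) (M n (D n) + ξ n)‖ ≤ ‖R (n + 1)‖ * (K * ‖D n‖ + K) := by
        refine ((R (n + 1)).le_opNorm _).trans ?_
        gcongr
        refine (norm_add_le _ _).trans (add_le_add (((M n).le_opNorm _).trans ?_) (hξ n))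
        gcongr; exact hM n
      have j2 : ‖T (R n (D n))‖ ≤ ‖T‖ * (‖R n‖ * ‖D n‖) :=
        (T.le_opNorm _).trans (by gcongr; exact (R n).le_opNorm _)
      have j3 : ‖T (Z n)‖ ≤ ‖T‖ * ‖Z n‖ := T.le_opNorm _
      have j4 : (‖T‖ * ‖R n‖ + K * ‖R (n + 1)‖) * ‖D n‖
          ≤ (‖T‖ * ‖R n‖ + K * ‖R (n + 1)‖) * (2 * (‖y n‖ + ‖Z n‖)) := by gcongr
      calc _ ≤ ‖R (n + 1) (M n (D n) + ξ n)‖ + ‖T (R n (D n))‖ + ‖T (Z n)‖ :=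
            (norm_sub_le _ _).trans (by gcongr; exact norm_sub_le _ _)
        _ ≤ _ := by simp only [he, hs]; linarith
    have ha' := ha n
    calc q (y (n + 1)) ≤ (1 - c * a n) * q (y n) + a n * (C * (s n * ‖y n‖ + e n)) := by
          rw [hstep n]
          refine (map_add_le_add q _ _).trans (add_le_add (hq _ ha'.le i2.le _) ?_)
          rw [map_smul_eq_mul, Real.norm_of_nonneg ha'.le]
          gcongr
          exact (hq2 _).trans (by gcongr)
      _ = (1 - c * a n) * q (y n) + a n * (C * s n * ‖y n‖) + a n * (C * e n) := by ring
      _ ≤ (1 - c * a n) * q (y n) + a n * (c / 2 * q (y n)) + a n * (C * e n) := by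
          gcongr
          exact hq1 _
      _ = _ := by ring
  have hfin : (fun n => 2 * (q (y n) + ‖Z n‖)) =o[atTop] p :=
    (hqy.add hZp.norm_left).const_mul_left 2
  refine IsBigO.trans_isLittleO (IsBigO.of_bound 1 ?_) hfin
  filter_upwards [hDy] with n hn
  rw [one_mul, Real.norm_of_nonneg (by have := apply_nonneg q (y n); positivity)]
  refine hn.trans ?_
  gcongr
  exact hq1 _

/-! ### From Hurwitz matrices to contractions -/

/-- By Gelfand's formula ‖B^n‖^(1/n) tends to the spectral radius, which is < 1, so the powers are
eventually dominated by a geometric sequence. -/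
theorem tendsto_pow_zero_of_spectrum_lt_one {𝓐 : Type*} [NormedRing 𝓐] [NormedAlgebra ℂ 𝓐]
    [CompleteSpace 𝓐] (B : 𝓐) (hB : ∀ z ∈ spectrum ℂ B, ‖z‖ < 1) :
    Tendsto (fun n => ‖B ^ n‖) atTop (𝓝 0) := by
  rcases subsingleton_or_nontrivial 𝓐 with h | h
  · simp [Subsingleton.elim _ (0 : 𝓐)]
  have hρ : spectralRadius ℂ B < (1 : NNReal) :=
    spectrum.spectralRadius_lt_of_forall_lt B fun z hz => hB z hz
  obtain ⟨r, hr1, hr2⟩ := ENNReal.lt_iff_exists_nnreal_btwn.1 hρ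
  have hr2' : r < 1 := by exact_mod_cast hr2
  have hev := (spectrum.pow_nnnorm_pow_one_div_tendsto_nhds_spectralRadius B).eventually_lt_const hr1
  refine squeeze_zero' (Eventually.of_forall fun n => norm_nonneg _) ?_
    (tendsto_pow_atTop_nhds_zero_of_lt_one r.2 (by exact_mod_cast hr2'))
  filter_upwards [hev, eventually_gt_atTop 0] with n hn hn0
  have hn0' : (0 : ℝ) < n := by exact_mod_cast hn0
  have h1 := ENNReal.rpow_le_rpow hn.le hn0'.le
  rw [← ENNReal.rpow_mul, one_div_mul_cancel hn0'.ne', ENNReal.rpow_one, ENNReal.rpow_natCast] at h1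
  exact_mod_cast h1

/-- For a Hurwitz matrix `M`, the powers of `1 + α M` tend to zero for some `α > 0`. -/
theorem IsHurwitz.exists_tendsto_pow {d : ℕ} {M : Matrix (Fin d) (Fin d) ℝ} (hM : IsHurwitz M) :
    ∃ α : ℝ, 0 < α ∧ Tendsto (fun n : ℕ => (1 + α • M) ^ n) atTop (𝓝 0) := by
  set Mc := M.map (algebraMap ℝ ℂ) with hMc
  -- |1 + α z|² = 1 + α (2 Re z + α |z|²) is < 1 for small α > 0 when Re z < 0; finiteness of the
  -- spectrum gives one α for all eigenvalues.
  have hev : ∀ᶠ α : ℝ in 𝓝[>] 0, ∀ z ∈ spectrum ℂ Mc, ‖1 + (α : ℂ) * z‖ < 1 := by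
    rw [(Matrix.finite_spectrum Mc).eventually_all]
    intro z hz
    have hz' := hM z hz
    have h1 : Tendsto (fun α : ℝ => 2 * z.re + α * Complex.normSq z) (𝓝[>] 0) (𝓝 (2 * z.re)) := by
      have : Continuous fun α : ℝ => 2 * z.re + α * Complex.normSq z := by fun_prop
      have h2 := this.tendsto 0
      simp only [zero_mul, add_zero] at h2
      exact h2.mono_left nhdsWithin_le_nhds
    filter_upwards [h1.eventually_lt_const (by linarith : 2 * z.re < 0), self_mem_nhdsWithin]
      with α h2 h3
    have h3' : 0 < α := h3
    have h4 : ‖1 + (α : ℂ) * z‖ ^ 2 = 1 + α * (2 * z.re + α * Complex.normSq z) := by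
      rw [← Complex.normSq_eq_norm_sq, Complex.normSq_apply, Complex.normSq_apply]
      simp
      ring
    have h5 : ‖1 + (α : ℂ) * z‖ ^ 2 < 1 := by rw [h4]; nlinarith
    nlinarith [norm_nonneg (1 + (α : ℂ) * z)]
  obtain ⟨α, hα, hα0⟩ := (hev.and self_mem_nhdsWithin).exists
  have hα0' : 0 < α := hα0
  have hαc : (α : ℂ) ≠ 0 := by exact_mod_cast hα0'.ne'
  refine ⟨α, hα0', ?_⟩
  have hspec : ∀ z ∈ spectrum ℂ (1 + (α : ℂ) • Mc), ‖z‖ < 1 := by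
    intro z hz
    have h1 : (z - 1) / α ∈ spectrum ℂ Mc := by
      have h2 : z ∈ spectrum ℂ (algebraMap ℂ _ 1 + (α : ℂ) • Mc) := by simpa using hz
      rw [← spectrum.singleton_add_eq] at h2
      obtain ⟨_, rfl, w, hw, rfl⟩ := Set.mem_add.1 h2
      have h3 := spectrum.smul_mem_smul_iff (R := ℂ) (s := w / α) (a := Mc) (r := Units.mk0 (α : ℂ) hαc)
      have h4 : Units.mk0 (α : ℂ) hαc • (w / (α : ℂ)) = w := by
        simp only [Units.smul_def, Units.val_mk0, smul_eq_mul]; field_simp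
      rw [h4] at h3
      have h5 := h3.1 hw
      simpa using h5
    have h2 := hα _ h1
    rwa [mul_div_cancel₀ _ hαc, add_sub_cancel] at h2
  have h0 := tendsto_pow_zero_of_spectrum_lt_one (1 + (α : ℂ) • Mc) hspec
  refine tendsto_zero_iff_norm_tendsto_zero.2 ?_
  refine h0.congr fun n => ?_
  have h1 : (1 + (α : ℂ) • Mc) ^ n = ((1 + α • M) ^ n).map (algebraMap ℝ ℂ) := by
    have h2 : 1 + (α : ℂ) • Mc = (algebraMap ℝ ℂ).mapMatrix (1 + α • M) := by
      ext i j
      simp [hMc, Matrix.one_apply, apply_ite]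
    rw [h2, ← map_pow]; rfl
  rw [h1]
  exact Matrix.frobenius_norm_map_eq _ _ fun a => by simp

theorem IsHurwitz.exists_seminorm_contraction {d : ℕ} {M : Matrix (Fin d) (Fin d) ℝ}
    (hM : IsHurwitz M) :
    ∃ (q : Seminorm ℝ (EuclideanSpace ℝ (Fin d))) (C c α₀ : ℝ), 0 < C ∧ 0 < c ∧ 0 < α₀ ∧
      (∀ x, ‖x‖ ≤ q x) ∧ (∀ x, q x ≤ C * ‖x‖) ∧
      ∀ α, 0 ≤ α → α ≤ α₀ → ∀ x,
        q (x + α • Matrix.toEuclideanCLM (𝕜 := ℝ) M x) ≤ (1 - c * α) * q x := by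
  obtain ⟨α, hα, hlim⟩ := hM.exists_tendsto_pow
  let f : Matrix (Fin d) (Fin d) ℝ →ₗ[ℝ]
      (EuclideanSpace ℝ (Fin d) →L[ℝ] EuclideanSpace ℝ (Fin d)) :=
    { toFun := fun B => Matrix.toEuclideanCLM (n := Fin d) (𝕜 := ℝ) B
      map_add' := fun B C => map_add _ B C
      map_smul' := fun c B => map_smul _ c B }
  have hcont : Continuous fun B : Matrix (Fin d) (Fin d) ℝ =>
      ‖Matrix.toEuclideanCLM (n := Fin d) (𝕜 := ℝ) B‖ :=
    f.continuous_of_finiteDimensional.norm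
  have h0 := (hcont.tendsto 0).comp hlim
  rw [map_zero, norm_zero] at h0
  obtain ⟨N, h1, h2⟩ := ((h0.eventually_lt_const one_pos).and (eventually_ne_atTop 0)).exists
  have h3 : ‖(1 + α • Matrix.toEuclideanCLM (n := Fin d) (𝕜 := ℝ) M) ^ N‖ < 1 := by
    have : Matrix.toEuclideanCLM (n := Fin d) (𝕜 := ℝ) ((1 + α • M) ^ N)
        = (1 + α • Matrix.toEuclideanCLM (n := Fin d) (𝕜 := ℝ) M) ^ N := by
      rw [map_pow, map_add, map_one, map_smul]
    rw [← this]; exact h1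
  obtain ⟨q, C, c, h⟩ := _root_.exists_seminorm_contraction _ hα h2 h3
  exact ⟨q, C, c, α, h.1, h.2.1, hα, h.2.2⟩

/-! ### Tails of weighted series and step-size asymptotics -/

/-- If `∑ xᵢ` converges and `p` is positive and decreasing, then `∑ pᵢ xᵢ` converges with a tail of
order `o(p)`. -/
theorem exists_tail_isLittleO {p x : ℕ → ℝ} (hp : ∀ n, 0 < p n) (hanti : Antitone p)
    (hx : ∃ L, Tendsto (fun n => ∑ i ∈ Finset.range n, x i) atTop (𝓝 L)) :
    ∃ L, (fun n => L - ∑ i ∈ Finset.range n, p i * x i) =o[atTop] p := by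
  obtain ⟨L₀, hL₀⟩ := hx
  set U : ℕ → ℝ := fun n => ∑ i ∈ Finset.range n, x i with hU
  set S : ℕ → ℝ := fun n => ∑ i ∈ Finset.range n, p i * x i with hS
  have key : ∀ ε : ℝ, 0 < ε → ∃ N, ∀ n, N ≤ n → ∀ m, n ≤ m → |S m - S n| ≤ ε * p n := by
    intro ε hε
    obtain ⟨N, hN⟩ := Metric.cauchySeq_iff.1 hL₀.cauchySeq ε hε
    refine ⟨N, fun n hn m hm => ?_⟩
    have hUn : ∀ m, n ≤ m → |U m - U n| ≤ ε := fun m hm => (hN m (hn.trans hm) n hn).le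
    -- Abel summation in inductive form: each step adds (p_m - p_{m+1}) (U_{m+1} - U_n), and these
    -- bounds telescope to ε (p_n - p_m).
    have h1 : |S m - S n - p m * (U m - U n)| ≤ ε * (p n - p m) := by
      induction m, hm using Nat.le_induction with
      | base => simp
      | succ m hm ih =>
        have e1 : S (m + 1) = S m + p m * x m := Finset.sum_range_succ _ _
        have e2 : U (m + 1) = U m + x m := Finset.sum_range_succ _ _
        have e3 : S (m + 1) - S n - p (m + 1) * (U (m + 1) - U n)
            = (S m - S n - p m * (U m - U n)) + (p m - p (m + 1)) * (U (m + 1) - U n) := by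
          rw [e1, e2]; ring
        have e4 : 0 ≤ p m - p (m + 1) := sub_nonneg.2 (hanti (Nat.le_succ m))
        rw [e3]
        refine (abs_add_le _ _).trans ?_
        rw [abs_mul, abs_of_nonneg e4]
        have := mul_le_mul_of_nonneg_left (hUn (m + 1) (hm.trans (Nat.le_succ m))) e4
        linarith
    have h2 : |p m * (U m - U n)| ≤ p m * ε := by
      rw [abs_mul, abs_of_pos (hp m)]
      exact mul_le_mul_of_nonneg_left (hUn m hm) (hp m).le
    have h3 := abs_add_le (S m - S n - p m * (U m - U n)) (p m * (U m - U n))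
    rw [sub_add_cancel] at h3
    linarith
  have hcau : CauchySeq S := by
    refine Metric.cauchySeq_iff'.2 fun ε hε => ?_
    have hp0 := hp 0
    obtain ⟨N, hN⟩ := key (ε / (2 * p 0)) (by positivity)
    refine ⟨N, fun n hn => ?_⟩
    refine (hN N le_rfl n hn).trans_lt ?_
    calc ε / (2 * p 0) * p N ≤ ε / (2 * p 0) * p 0 := by gcongr; exact hanti (Nat.zero_le N)
      _ = ε / 2 := by field_simp
      _ < ε := half_lt_self hε
  obtain ⟨L, hL⟩ := cauchySeq_tendsto_of_complete hcau
  refine ⟨L, isLittleO_iff.2 fun ε hε => ?_⟩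
  obtain ⟨N, hN⟩ := key ε hε
  filter_upwards [eventually_ge_atTop N] with n hn
  rw [Real.norm_of_nonneg (hp n).le]
  exact le_of_tendsto ((hL.sub_const (S n)).norm)
    ((eventually_ge_atTop n).mono fun m hm => hN n hn m hm)

theorem stepSize_succ_pos {α₀ η : ℝ} (hα₀ : 0 < α₀) (n : ℕ) : 0 < stepSize α₀ η (n + 1) := by
  unfold stepSize; positivity

theorem tendsto_natCast_add_one : Tendsto (fun n : ℕ => ((n + 1 : ℕ) : ℝ)) atTop atTop :=
  tendsto_natCast_atTop_atTop.comp (tendsto_add_atTop_nat 1)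

theorem antitone_succ_rpow_neg {s : ℝ} (hs : 0 ≤ s) :
    Antitone fun n : ℕ => ((n + 1 : ℕ) : ℝ) ^ (-s) := by
  intro m n hmn
  exact Real.rpow_le_rpow_of_nonpos (by positivity) (by exact_mod_cast Nat.succ_le_succ hmn)
    (by linarith)

theorem tendsto_succ_rpow_neg {s : ℝ} (hs : 0 < s) :
    Tendsto (fun n : ℕ => ((n + 1 : ℕ) : ℝ) ^ (-s)) atTop (𝓝 0) :=
  (tendsto_rpow_neg_atTop hs).comp tendsto_natCast_add_one

theorem stepSize_succ_eq (α₀ η : ℝ) (n : ℕ) :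
    stepSize α₀ η (n + 1) = α₀ * ((n + 1 : ℕ) : ℝ) ^ (-η) := by
  rw [stepSize, Real.rpow_neg (by positivity), div_eq_mul_inv]

theorem tendsto_stepSize_succ (α₀ : ℝ) {η : ℝ} (hη : 0 < η) :
    Tendsto (fun n => stepSize α₀ η (n + 1)) atTop (𝓝 0) := by
  simp_rw [stepSize_succ_eq]
  simpa using (tendsto_succ_rpow_neg hη).const_mul α₀

theorem tendsto_sum_stepSize_succ {α₀ η : ℝ} (hα₀ : 0 < α₀) (hη : η ≤ 1) :
    Tendsto (fun n => ∑ i ∈ Finset.range n, stepSize α₀ η (i + 1)) atTop atTop := by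
  refine tendsto_atTop_mono (fun n => ?_)
    (Real.tendsto_sum_range_one_div_nat_succ_atTop.const_mul_atTop hα₀)
  rw [Finset.mul_sum]
  refine Finset.sum_le_sum fun i _ => ?_
  rw [stepSize, div_eq_mul_one_div α₀]
  push_cast
  have h1 : (1 : ℝ) ≤ i + 1 := by simp
  refine mul_le_mul_of_nonneg_left (one_div_le_one_div_of_le (by positivity) ?_) hα₀.le
  calc ((i : ℝ) + 1) ^ η ≤ ((i : ℝ) + 1) ^ (1 : ℝ) := Real.rpow_le_rpow_of_exponent_le h1 hη
    _ = i + 1 := Real.rpow_one _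

theorem isLittleO_one_div_succ_stepSize {α₀ η : ℝ} (hα₀ : 0 < α₀) (hη : η < 1) :
    (fun n : ℕ => 1 / ((n + 1 : ℕ) : ℝ)) =o[atTop] fun n => stepSize α₀ η (n + 1) := by
  rw [isLittleO_iff_tendsto fun n hn => absurd hn (stepSize_succ_pos hα₀ n).ne']
  have h := (tendsto_succ_rpow_neg (sub_pos.2 hη)).const_mul α₀⁻¹
  rw [mul_zero] at h
  refine h.congr fun n => ?_
  have h1 : (0 : ℝ) < ((n + 1 : ℕ) : ℝ) := by positivity
  rw [stepSize, neg_sub, Real.rpow_sub h1, Real.rpow_one]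
  field_simp

/-- Supplies δ_n = 1/(n+1) as the relative decrease of the rate n^(-γ): the ratio of consecutive
terms is (1 + 1/(n+1))^γ, and γ ≤ 1 removes the exponent. -/
theorem succ_rpow_neg_le {γ : ℝ} (hγ1 : γ ≤ 1) (n : ℕ) :
    ((n + 1 : ℕ) : ℝ) ^ (-γ)
      ≤ (1 + 1 / ((n + 1 : ℕ) : ℝ)) * ((n + 1 + 1 : ℕ) : ℝ) ^ (-γ) := by
  have h1 : (0 : ℝ) < ((n + 1 : ℕ) : ℝ) := by positivity
  have h2 : (0 : ℝ) < ((n + 1 + 1 : ℕ) : ℝ) := by positivity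
  have h3 : 1 + 1 / ((n + 1 : ℕ) : ℝ) = ((n + 1 + 1 : ℕ) : ℝ) / ((n + 1 : ℕ) : ℝ) := by
    field_simp; push_cast; ring
  have h4 : (1 : ℝ) ≤ ((n + 1 + 1 : ℕ) : ℝ) / ((n + 1 : ℕ) : ℝ) := by
    rw [← h3]; have : 0 ≤ 1 / ((n + 1 : ℕ) : ℝ) := by positivity
    linarith
  have h5 : ((n + 1 : ℕ) : ℝ) ^ (-γ)
      = (((n + 1 + 1 : ℕ) : ℝ) / ((n + 1 : ℕ) : ℝ)) ^ γ * ((n + 1 + 1 : ℕ) : ℝ) ^ (-γ) := by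
    rw [Real.div_rpow h2.le h1.le, Real.rpow_neg h1.le, Real.rpow_neg h2.le]
    field_simp
  rw [h5, h3]
  gcongr
  calc _ ≤ (((n + 1 + 1 : ℕ) : ℝ) / ((n + 1 : ℕ) : ℝ)) ^ (1 : ℝ) :=
        Real.rpow_le_rpow_of_exponent_le h4 hγ1
    _ = _ := Real.rpow_one _

theorem summable_sq_mul_succ_rpow_neg (α₀ : ℝ) {s : ℝ} (hs : 1 / 2 < s) :
    Summable fun n : ℕ => (α₀ * ((n + 1 : ℕ) : ℝ) ^ (-s)) ^ 2 := by
  have h := (summable_nat_add_iff 1).2 (Real.summable_nat_rpow.2 (by linarith : -(2 * s) < -1))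
  refine (h.mul_left (α₀ ^ 2)).congr fun n => ?_
  rw [mul_pow, ← Real.rpow_natCast (_ ^ _), ← Real.rpow_mul (by positivity)]
  congr 2
  push_cast; ring

/-! ### Martingale series -/

/-- A series `∑ cᵢ Dᵢ` with bounded martingale differences `Dᵢ` and square summable `cᵢ` converges
almost surely. -/
theorem ae_exists_tendsto_sum_of_condExp_eq_zero {Ω : Type*} {mΩ : MeasurableSpace Ω}
    {P : Measure Ω} [IsProbabilityMeasure P] {ℱ : Filtration ℕ mΩ} {D : ℕ → Ω → ℝ} {K : ℝ}
    {c : ℕ → ℝ} (hD : ∀ n, Measurable[ℱ (n + 1)] (D n)) (hK : ∀ n, ∀ᵐ ω ∂P, |D n ω| ≤ K)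
    (h0 : ∀ n, P[D n | ℱ n] =ᵐ[P] 0) (hc : Summable fun n => c n ^ 2) :
    ∀ᵐ ω ∂P, ∃ L, Tendsto (fun n => ∑ i ∈ Finset.range n, c i * D i ω) atTop (𝓝 L) := by
  set M : ℕ → Ω → ℝ := fun n ω => ∑ i ∈ Finset.range n, c i * D i ω with hM
  have hDm : ∀ n, Measurable (D n) := fun n => (hD n).mono (ℱ.le _) le_rfl
  have hMad : ∀ n, Measurable[ℱ n] (M n) := fun n =>
    Finset.measurable_fun_sum _ fun i hi =>
      ((hD i).mono (ℱ.mono (Finset.mem_range.1 hi)) le_rfl).const_mul _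
  have hMm : ∀ n, Measurable (M n) := fun n => (hMad n).mono (ℱ.le _) le_rfl
  have hMb : ∀ n, ∃ B, ∀ᵐ ω ∂P, |M n ω| ≤ B := by
    intro n
    refine ⟨∑ i ∈ Finset.range n, |c i| * K, ?_⟩
    filter_upwards [ae_all_iff.2 hK] with ω hω
    refine (Finset.abs_sum_le_sum_abs _ _).trans (Finset.sum_le_sum fun i _ => ?_)
    rw [abs_mul]
    gcongr
    exact hω i
  have hint : ∀ {f : Ω → ℝ}, Measurable f → (∃ B, ∀ᵐ ω ∂P, |f ω| ≤ B) → Integrable f P :=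
    fun hf ⟨B, hB⟩ => Integrable.of_bound hf.aestronglyMeasurable B hB
  have hDi : ∀ n, Integrable (D n) P := fun n => hint (hDm n) ⟨K, hK n⟩
  have hMi : ∀ n, Integrable (M n) P := fun n => hint (hMm n) (hMb n)
  have hMD : ∀ n, Integrable (M n * D n) P := by
    intro n
    obtain ⟨B, hB⟩ := hMb n
    refine hint ((hMm n).mul (hDm n)) ⟨B * K, ?_⟩
    filter_upwards [hB, hK n] with ω h1 h2
    rw [Pi.mul_apply, abs_mul]
    have := abs_nonneg (M n ω)
    gcongr
    linarith
  have hD2 : ∀ n, Integrable (fun ω => D n ω ^ 2) P := by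
    intro n
    refine hint ((hDm n).pow_const 2) ⟨K ^ 2, ?_⟩
    filter_upwards [hK n] with ω h2
    rw [abs_pow]
    gcongr
  have hM2 : ∀ n, Integrable (fun ω => M n ω ^ 2) P := by
    intro n
    obtain ⟨B, hB⟩ := hMb n
    refine hint ((hMm n).pow_const 2) ⟨B ^ 2, ?_⟩
    filter_upwards [hB] with ω h2
    rw [abs_pow]
    gcongr
  have hsucc : ∀ n ω, M (n + 1) ω = M n ω + c n * D n ω := fun n ω => Finset.sum_range_succ _ _
  have hmart : Martingale M ℱ P := by
    refine martingale_of_condExp_sub_eq_zero_nat (fun n => (hMad n).stronglyMeasurable) hMi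
      fun n => ?_
    have h1 : M (n + 1) - M n = c n • D n := by
      ext ω; simp [hsucc]
    rw [h1]
    refine (condExp_smul (c n) (D n) (ℱ n)).trans ?_
    filter_upwards [h0 n] with ω hω
    simp [hω]
  have horth : ∀ n, ∫ ω, M n ω * D n ω ∂P = 0 := by
    intro n
    have h1 := condExp_mul_of_stronglyMeasurable_left (μ := P) (m := ℱ n)
      (hMad n).stronglyMeasurable (hMD n) (hDi n)
    calc ∫ ω, M n ω * D n ω ∂P = ∫ ω, (P[M n * D n | ℱ n]) ω ∂P := (integral_condExp (ℱ.le n)).symm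
      _ = ∫ ω, (0 : ℝ) ∂P := by
        refine integral_congr_ae ?_
        filter_upwards [h1, h0 n] with ω h2 h3
        simp [h2, h3]
      _ = 0 := by simp
  -- Orthogonality of the increments removes the cross term.
  have hsq : ∀ n, ∫ ω, M n ω ^ 2 ∂P ≤ K ^ 2 * ∑ i ∈ Finset.range n, c i ^ 2 := by
    intro n
    induction n with
    | zero => simp [hM]
    | succ n ih =>
      have h1 : ∀ ω, M (n + 1) ω ^ 2
          = M n ω ^ 2 + (2 * c n) * (M n ω * D n ω) + c n ^ 2 * D n ω ^ 2 := fun ω => by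
        rw [hsucc]; ring
      have h2 : ∫ ω, D n ω ^ 2 ∂P ≤ K ^ 2 := by
        have := integral_mono_ae (hD2 n) (integrable_const (K ^ 2)) (by
          filter_upwards [hK n] with ω hω
          rw [← sq_abs]; gcongr)
        simpa using this
      have h3 : Integrable (fun ω => (2 * c n) * (M n ω * D n ω)) P := (hMD n).const_mul _
      simp_rw [h1]
      have h4 : Integrable (fun ω => M n ω ^ 2 + (2 * c n) * (M n ω * D n ω)) P := (hM2 n).add h3
      rw [integral_add h4 ((hD2 n).const_mul _), integral_add (hM2 n) h3, integral_const_mul, integral_const_mul, horth, Finset.sum_range_succ]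
      nlinarith [mul_le_mul_of_nonneg_left h2 (sq_nonneg (c n))]
  -- Martingale convergence needs an L¹ bound; |x| ≤ 1 + x² extracts it from the L² bound.
  have hbdd : ∀ n, eLpNorm (M n) 1 P ≤ (Real.toNNReal (1 + K ^ 2 * ∑' i, c i ^ 2) : NNReal) := by
    intro n
    rw [eLpNorm_one_eq_lintegral_enorm, ← ofReal_integral_norm_eq_lintegral_enorm (hMi n)]
    refine ENNReal.ofReal_le_ofReal ?_
    calc ∫ ω, ‖M n ω‖ ∂P ≤ ∫ ω, (1 + M n ω ^ 2) ∂P := by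
          refine integral_mono (hMi n).norm ((integrable_const 1).add (hM2 n)) fun ω => ?_
          change |M n ω| ≤ 1 + M n ω ^ 2
          rw [← sq_abs]
          nlinarith [sq_nonneg (|M n ω| - 1)]
      _ = 1 + ∫ ω, M n ω ^ 2 ∂P := by
          rw [integral_add (integrable_const 1) (hM2 n)]; simp
      _ ≤ 1 + K ^ 2 * ∑' i, c i ^ 2 := by
          gcongr
          refine (hsq n).trans ?_
          gcongr
          exact hc.sum_le_tsum _ fun i _ => sq_nonneg _
  filter_upwards [hmart.submartingale.ae_tendsto_limitProcess hbdd] with ω hω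
  exact ⟨_, hω⟩

/-! ### Kernels, uniform ergodicity and the Poisson equation -/

/-- Integrals of bounded functions against measures that are close in total variation. -/
theorem abs_integral_sub_integral_le {S : Type*} [MeasurableSpace S] {ν₁ ν₂ : Measure S}
    [IsProbabilityMeasure ν₁] [IsProbabilityMeasure ν₂] {ε K : ℝ}
    (h : ∀ B, MeasurableSet B → |ν₁.real B - ν₂.real B| ≤ ε) {f : S → ℝ} (hf : Measurable f)
    (hK : ∀ x, |f x| ≤ K) : |∫ x, f x ∂ν₁ - ∫ x, f x ∂ν₂| ≤ 2 * K * ε := by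
  rcases isEmpty_or_nonempty S with hS | ⟨⟨x₀⟩⟩
  · exact absurd (IsProbabilityMeasure.ne_zero ν₁) (by simp [Measure.eq_zero_of_isEmpty])
  have hK0 : 0 ≤ K := (abs_nonneg _).trans (hK x₀)
  have hfi : ∀ (ν : Measure S) [IsProbabilityMeasure ν], Integrable f ν := fun ν _ =>
    Integrable.of_bound hf.aestronglyMeasurable K (ae_of_all _ hK)
  -- Layer cake for f + K, which takes values in [0, 2K]; the length of this interval is the
  -- constant 2K of the bound.
  have hlayer : ∀ (ν : Measure S) [IsProbabilityMeasure ν],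
      ∫ x, f x ∂ν = (∫ t in Set.Ioc 0 (2 * K), ν.real {x | t ≤ f x + K}) - K := by
    intro ν _
    have h1 := Integrable.integral_eq_integral_Ioc_meas_le (μ := ν) (f := fun x => f x + K)
      (M := 2 * K) ((hfi ν).add (integrable_const K))
      (ae_of_all _ fun x => by have := neg_le_of_abs_le (hK x); simp; linarith)
      (ae_of_all _ fun x => by have := le_of_abs_le (hK x); simp; linarith)
    rw [← h1, integral_add (hfi ν) (integrable_const K)]
    simp
  have hmi : ∀ (ν : Measure S) [IsProbabilityMeasure ν],
      IntegrableOn (fun t : ℝ => ν.real {x | t ≤ f x + K}) (Set.Ioc 0 (2 * K)) := by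
    intro ν _
    have hanti : Antitone fun t : ℝ => ν.real {x | t ≤ f x + K} := fun s t hst =>
      measureReal_mono fun x hx => hst.trans hx
    refine Measure.integrableOn_of_bounded (M := 1) measure_Ioc_lt_top.ne hanti.measurable.aestronglyMeasurable
      (ae_of_all _ fun t => ?_)
    rw [Real.norm_of_nonneg measureReal_nonneg]
    exact measureReal_le_one
  rw [hlayer ν₁, hlayer ν₂, sub_sub_sub_cancel_right, ← integral_sub (hmi ν₁) (hmi ν₂)]
  have h2 := norm_setIntegral_le_of_norm_le_const (μ := volume) (s := Set.Ioc 0 (2 * K)) (C := ε)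
    (f := fun t : ℝ => ν₁.real {x | t ≤ f x + K} - ν₂.real {x | t ≤ f x + K}) measure_Ioc_lt_top
    (fun t _ => h _ (measurableSet_le measurable_const (hf.add_const K)))
  rw [Real.norm_eq_abs] at h2
  refine h2.trans (le_of_eq ?_)
  rw [Measure.real, Real.volume_Ioc, ENNReal.toReal_ofReal (by linarith)]
  ring

section Kernel

variable {S : Type*} [MeasurableSpace S]

instance isMarkovKernel_pow (κ : Kernel S S) [IsMarkovKernel κ] (n : ℕ) :
    IsMarkovKernel (κ ^ n) := by
  induction n with
  | zero => rw [pow_zero]; exact inferInstanceAs (IsMarkovKernel Kernel.id)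
  | succ n ih => rw [pow_succ]; exact inferInstanceAs (IsMarkovKernel ((κ ^ n) ∘ₖ κ))

theorem integrable_of_measurable_of_abs_le {ν : Measure S} [IsFiniteMeasure ν] {f : S → ℝ} {K : ℝ}
    (hf : Measurable f) (hK : ∀ x, |f x| ≤ K) : Integrable f ν :=
  Integrable.of_bound hf.aestronglyMeasurable K (ae_of_all _ hK)

theorem abs_integral_le_of_abs_le {ν : Measure S} [IsProbabilityMeasure ν] {f : S → ℝ} {K : ℝ}
    (hK : ∀ x, |f x| ≤ K) : |∫ x, f x ∂ν| ≤ K := by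
  simpa using norm_integral_le_of_norm_le_const (μ := ν) (f := f) (C := K) (ae_of_all _ hK)

theorem measurable_integral_kernel {κ : Kernel S S} [IsMarkovKernel κ] {f : S → ℝ}
    (hf : Measurable f) : Measurable fun x => ∫ y, f y ∂κ x :=
  hf.stronglyMeasurable.integral_kernel.measurable

theorem integral_bind_kernel {ν : Measure S} [IsFiniteMeasure ν] {κ : Kernel S S}
    [IsMarkovKernel κ] {f : S → ℝ} {K : ℝ} (hf : Measurable f) (hK : ∀ x, |f x| ≤ K) :
    ∫ y, f y ∂(ν.bind κ) = ∫ x, ∫ y, f y ∂κ x ∂ν := by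
  have h1 : (κ ∘ₖ Kernel.const Unit ν) () = ν.bind κ := by
    rw [Kernel.comp_apply, Kernel.const_apply]
  have h2 := Kernel.integral_comp (η := κ) (κ := Kernel.const Unit ν) (a := ()) (f := f)
    (integrable_of_measurable_of_abs_le hf hK)
  rwa [h1, Kernel.const_apply] at h2

theorem integral_pow_add {κ : Kernel S S} [IsMarkovKernel κ] {f : S → ℝ} {K : ℝ}
    (hf : Measurable f) (hK : ∀ x, |f x| ≤ K) (m n : ℕ) (x : S) :
    ∫ y, f y ∂(κ ^ (m + n)) x = ∫ z, ∫ y, f y ∂(κ ^ m) z ∂(κ ^ n) x := by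
  rw [Kernel.pow_add]
  exact Kernel.integral_comp (integrable_of_measurable_of_abs_le hf hK)

theorem Kernel.Invariant.integral_pow {κ : Kernel S S} [IsMarkovKernel κ] {μ : Measure S}
    [IsProbabilityMeasure μ] (hμ : Kernel.Invariant κ μ) {f : S → ℝ} {K : ℝ}
    (hf : Measurable f) (hK : ∀ x, |f x| ≤ K) (n : ℕ) :
    ∫ x, ∫ y, f y ∂(κ ^ n) x ∂μ = ∫ x, f x ∂μ := by
  induction n with
  | zero =>
    refine integral_congr_ae (ae_of_all _ fun x => ?_)
    change ∫ y, f y ∂(Kernel.id x) = f x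
    rw [Kernel.id_apply, integral_dirac' _ _ hf.stronglyMeasurable]
  | succ n ih =>
    simp_rw [integral_pow_add hf hK n 1, pow_one]
    rw [← integral_bind_kernel (measurable_integral_kernel hf)
      (fun x => abs_integral_le_of_abs_le hK), hμ, ih]

variable {κ : Kernel S S} [IsMarkovKernel κ] {μ : Measure S} [IsProbabilityMeasure μ]

/-- Uniform ergodicity yields geometric convergence of the semigroup on centred functions. -/
theorem IsUniformlyErgodic.exists_geometric (hκ : IsUniformlyErgodic κ μ) :
    ∃ r : ℝ, 0 ≤ r ∧ r < 1 ∧ ∀ (f : S → ℝ) (K : ℝ), Measurable f → (∀ x, |f x| ≤ K) →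
      ∫ x, f x ∂μ = 0 → ∀ n x, |∫ y, f y ∂(κ ^ n) x| ≤ 2 * K * r ^ n := by
  -- With 1/4, the bound 2 K ε equals K / 2: N steps halve the sup norm of a centred function. Hence
  -- r^N = 1/2, and the prefactor 2 covers n < N, where r^n ≥ 1/2.
  obtain ⟨N₀, hN₀⟩ := hκ.tendsto (1 / 4) (by norm_num)
  set N := N₀ + 1 with hN
  have hNpos : (0 : ℝ) < N := by positivity
  set r : ℝ := (1 / 2 : ℝ) ^ (1 / N : ℝ) with hr
  have hr0 : 0 < r := by positivity
  have hr1 : r < 1 := Real.rpow_lt_one (by norm_num) (by norm_num) (by positivity)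
  have hrN : r ^ N = 1 / 2 := by
    rw [hr, ← Real.rpow_natCast, ← Real.rpow_mul (by norm_num), one_div_mul_cancel hNpos.ne',
      Real.rpow_one]
  refine ⟨r, hr0.le, hr1, ?_⟩
  intro f K hf hK hfμ n
  induction n using Nat.strong_induction_on generalizing f K with
  | _ n ih =>
    intro x
    have hK0 : 0 ≤ K := (abs_nonneg _).trans (hK x)
    rcases lt_or_ge n N with hn | hn
    · refine (abs_integral_le_of_abs_le hK).trans ?_
      have : 1 / 2 ≤ r ^ n := by
        rw [← hrN]; exact pow_le_pow_of_le_one hr0.le hr1.le hn.le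
      nlinarith
    · obtain ⟨m, rfl⟩ := Nat.exists_eq_add_of_le hn
      have hstep : ∀ x, |∫ y, f y ∂(κ ^ N) x| ≤ K / 2 := by
        intro x
        have := abs_integral_sub_integral_le (ν₁ := (κ ^ N) x) (ν₂ := μ)
          (hN₀ N (Nat.le_succ _) x) hf hK
        rw [hfμ, sub_zero] at this
        linarith
      rw [integral_pow_add hf hK]
      -- The induction runs over all centred functions: κ^N f is bounded by K / 2 and is again
      -- centred, by invariance of μ.
      have h1 := ih m (by omega) (fun z => ∫ y, f y ∂(κ ^ N) z) (K / 2)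
        (measurable_integral_kernel hf) hstep (by
          rw [Kernel.Invariant.integral_pow hκ.stationary hf hK, hfμ]) x
      refine h1.trans (le_of_eq ?_)
      rw [pow_add, hrN]; ring

/-- The Poisson equation of a uniformly ergodic chain has bounded solutions. -/
theorem IsUniformlyErgodic.exists_poisson (hκ : IsUniformlyErgodic κ μ) {f : S → ℝ} {K : ℝ}
    (hf : Measurable f) (hK : ∀ x, |f x| ≤ K) :
    ∃ (g : S → ℝ) (C : ℝ), Measurable g ∧ (∀ x, |g x| ≤ C) ∧
      ∀ x, g x - ∫ y, g y ∂κ x = f x - ∫ y, f y ∂μ := by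
  obtain ⟨r, hr0, hr1, hgeo⟩ := hκ.exists_geometric
  set m := ∫ y, f y ∂μ with hm
  have hm' : |m| ≤ K := abs_integral_le_of_abs_le hK
  set h : S → ℝ := fun x => f x - m with hh
  have hhm : Measurable h := hf.sub_const m
  have hhK : ∀ x, |h x| ≤ 2 * K := fun x => (abs_sub _ _).trans (by linarith [hK x])
  have hhμ : ∫ x, h x ∂μ = 0 := by
    rw [integral_sub (integrable_of_measurable_of_abs_le hf hK) (integrable_const _)]
    simp [hm]
  set F : ℕ → S → ℝ := fun n x => ∫ y, h y ∂(κ ^ n) x with hF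
  have hFb : ∀ n x, |F n x| ≤ 2 * (2 * K) * r ^ n := hgeo h (2 * K) hhm hhK hhμ
  have hgs : Summable fun n => 2 * (2 * K) * r ^ n :=
    (summable_geometric_of_lt_one hr0 hr1).mul_left _
  have hFs : ∀ x, Summable fun n => F n x := fun x =>
    Summable.of_norm_bounded hgs fun n => hFb n x
  have hFm : ∀ n, Measurable (F n) := fun n => measurable_integral_kernel hhm
  -- The Neumann series g = Σ κ^n (f - μ(f)); applying κ drops its first term.
  refine ⟨fun x => ∑' n, F n x, ∑' n, 2 * (2 * K) * r ^ n, ?_, ?_, ?_⟩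
  · refine measurable_of_tendsto_metrizable (f := fun n x => ∑ i ∈ Finset.range n, F i x)
      (fun n => Finset.measurable_fun_sum _ fun i _ => hFm i) ?_
    exact tendsto_pi_nhds.2 fun x => (hFs x).hasSum.tendsto_sum_nat
  · exact fun x => tsum_of_norm_bounded (f := fun n => F n x) hgs.hasSum fun n => hFb n x
  · intro x
    have h1 : ∫ y, ∑' n, F n y ∂κ x = ∑' n, F (n + 1) x := by
      rw [← integral_tsum_of_summable_integral_norm (F := fun n y => F n y)]
      · refine tsum_congr fun n => ?_
        rw [hF]
        simp only
        rw [integral_pow_add hhm hhK n 1, pow_one]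
      · exact fun n => integrable_of_measurable_of_abs_le (hFm n) (hFb n)
      · refine Summable.of_nonneg_of_le (fun n => integral_nonneg fun y => norm_nonneg _)
          (fun n => ?_) hgs
        refine (le_abs_self _).trans (abs_integral_le_of_abs_le fun y => ?_)
        rw [abs_norm]; exact hFb n y
    simp only
    rw [h1, (hFs x).tsum_eq_zero_add]
    have h2 : F 0 x = h x := by
      change ∫ y, h y ∂(Kernel.id x) = h x
      rw [Kernel.id_apply, integral_dirac' _ _ hhm.stronglyMeasurable]
    rw [h2]; ring

end Kernel

/-! ### Weighted sums along the chain -/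

section Chain

variable {Ω S : Type*} [mΩ : MeasurableSpace Ω] [MeasurableSpace S] {P : Measure Ω}
  {κ : Kernel S S} {μ : Measure S} {Y : ℕ → Ω → S}

/-- The natural filtration of a Markov chain. -/
def IsMarkovChain.filtration (hY : IsMarkovChain P κ Y) : Filtration ℕ mΩ where
  seq n := ⨆ i ≤ n, MeasurableSpace.comap (Y i) inferInstance
  mono' _ _ hmn := biSup_mono fun _ hi => hi.trans hmn
  le' _ := iSup₂_le fun i _ => (hY.1 i).comap_le

theorem IsMarkovChain.measurable_filtration (hY : IsMarkovChain P κ Y) {i n : ℕ} (hi : i ≤ n) :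
    Measurable[hY.filtration n] (Y i) := by
  have h1 : MeasurableSpace.comap (Y i) inferInstance ≤ hY.filtration n :=
    le_iSup₂_of_le (f := fun i (_ : i ≤ n) => MeasurableSpace.comap (Y i) inferInstance) i hi le_rfl
  exact (comap_measurable (Y i)).mono h1 le_rfl

variable [IsProbabilityMeasure P] [IsMarkovKernel κ] [IsProbabilityMeasure μ]

/-- The Markov property for bounded functions. -/
theorem IsMarkovChain.condExp_comp (hY : IsMarkovChain P κ Y) {f : S → ℝ} {K : ℝ}
    (hf : Measurable f) (hK : ∀ x, |f x| ≤ K) (n : ℕ) :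
    P[fun ω => f (Y (n + 1) ω) | hY.filtration n] =ᵐ[P] fun ω => ∫ y, f y ∂κ (Y n ω) := by
  have hle := hY.filtration.le n
  have hT := measurable_integral_kernel (κ := κ) hf
  have hTm : Measurable[hY.filtration n] fun ω => ∫ y, f y ∂κ (Y n ω) :=
    hT.comp (hY.measurable_filtration le_rfl)
  have hi : ∀ ν : Measure Ω, IsFiniteMeasure ν → ∀ i, Integrable (fun ω => f (Y i ω)) ν :=
    fun ν _ i => integrable_of_measurable_of_abs_le (hf.comp (hY.1 i)) fun ω => hK _
  refine (ae_eq_condExp_of_forall_setIntegral_eq hle (hi P inferInstance _) (fun s _ _ => ?_)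
    (fun s hs _ => ?_) hTm.aestronglyMeasurable).symm
  · exact (integrable_of_measurable_of_abs_le (hTm.mono hle le_rfl)
      fun ω => abs_integral_le_of_abs_le hK).integrableOn
  -- The defining property concerns indicators only; restricting P to a past event `s` turns it into
  -- an identity of measures, which then integrates every bounded f.
  · have hbind : (P.restrict s).map (Y (n + 1)) = ((P.restrict s).map (Y n)).bind κ := by
      ext B hB
      rw [Measure.map_apply (hY.1 _) hB, Measure.bind_apply hB κ.aemeasurable,
        lintegral_map (κ.measurable_coe hB) (hY.1 n)]
      have hYB : MeasurableSet (Y (n + 1) ⁻¹' B) := hY.1 _ hB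
      have h1 : ∫ ω in s, (κ (Y n ω)).real B ∂P = (P.restrict s).real (Y (n + 1) ⁻¹' B) := by
        rw [← setIntegral_congr_ae (hle s hs) ((hY.2 n B hB).mono fun ω hω _ => hω)]
        refine (setIntegral_condExp hle ((integrable_const (1 : ℝ)).indicator hYB) hs).trans ?_
        rw [integral_indicator_const _ hYB]
        simp
      have hmeas : Measurable fun ω => (κ (Y n ω)).real B :=
        ((κ.measurable_coe hB).comp (hY.1 n)).ennreal_toReal
      have h2 := ofReal_integral_eq_lintegral_ofReal (μ := P.restrict s)
        (f := fun ω => (κ (Y n ω)).real B)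
        (integrable_of_measurable_of_abs_le (K := 1) hmeas fun ω => by
          rw [abs_of_nonneg measureReal_nonneg]; exact measureReal_le_one)
        (ae_of_all _ fun ω => measureReal_nonneg)
      rw [h1, ofReal_measureReal] at h2
      rw [h2]
      exact lintegral_congr fun ω => ofReal_measureReal
    have e1 : ∫ ω in s, f (Y (n + 1) ω) ∂P = ∫ y, f y ∂((P.restrict s).map (Y (n + 1))) :=
      (integral_map (hY.1 _).aemeasurable hf.aestronglyMeasurable).symm
    have e2 : ∫ ω in s, ∫ y, f y ∂κ (Y n ω) ∂P = ∫ x, ∫ y, f y ∂κ x ∂((P.restrict s).map (Y n)) :=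
      (integral_map (hY.1 _).aemeasurable hT.aestronglyMeasurable).symm
    rw [e1, e2, hbind, integral_bind_kernel hf hK]

theorem IsMarkovChain.integral_eq (hY : IsMarkovChain P κ Y) {f : S → ℝ} {K : ℝ}
    (hf : Measurable f) (hK : ∀ x, |f x| ≤ K) (n : ℕ) :
    ∫ ω, f (Y n ω) ∂P = ∫ ω, ∫ y, f y ∂(κ ^ n) (Y 0 ω) ∂P := by
  induction n generalizing f with
  | zero =>
    refine integral_congr_ae (ae_of_all _ fun ω => ?_)
    change f (Y 0 ω) = ∫ y, f y ∂(Kernel.id (Y 0 ω))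
    rw [Kernel.id_apply, integral_dirac' _ _ hf.stronglyMeasurable]
  | succ n ih =>
    rw [← integral_condExp (hY.filtration.le n), integral_congr_ae (hY.condExp_comp hf hK n),
      ih (measurable_integral_kernel hf) fun x => abs_integral_le_of_abs_le hK]
    refine integral_congr_ae (ae_of_all _ fun ω => ?_)
    simp only
    rw [add_comm n 1, integral_pow_add hf hK 1 n, pow_one]

/-- The total variation bound is uniform in the starting point, so it survives averaging over the
initial law. This identifies the limiting means with integrals against μ. -/
theorem IsMarkovChain.tendsto_integral (hY : IsMarkovChain P κ Y) (hκ : IsUniformlyErgodic κ μ)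
    {f : S → ℝ} {K : ℝ} (hf : Measurable f) (hK : ∀ x, |f x| ≤ K) :
    Tendsto (fun n => ∫ ω, f (Y n ω) ∂P) atTop (𝓝 (∫ x, f x ∂μ)) := by
  obtain ⟨ω₀⟩ : Nonempty Ω := P.nonempty_of_neZero
  have hK0 : 0 ≤ K := (abs_nonneg _).trans (hK (Y 0 ω₀))
  rw [Metric.tendsto_atTop]
  intro ε hε
  obtain ⟨N, hN⟩ := hκ.tendsto (ε / (4 * (K + 1))) (by positivity)
  refine ⟨N, fun n hn => ?_⟩
  have hm : Measurable fun ω => ∫ y, f y ∂(κ ^ n) (Y 0 ω) :=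
    (measurable_integral_kernel hf).comp (hY.1 0)
  have h1 : ∫ ω, f (Y n ω) ∂P - ∫ x, f x ∂μ
      = ∫ ω, (∫ y, f y ∂(κ ^ n) (Y 0 ω) - ∫ x, f x ∂μ) ∂P := by
    rw [hY.integral_eq hf hK, integral_sub (integrable_of_measurable_of_abs_le hm
      fun ω => abs_integral_le_of_abs_le hK) (integrable_const _)]
    simp
  rw [Real.dist_eq, h1]
  refine (abs_integral_le_of_abs_le fun ω =>
    abs_integral_sub_integral_le (hN n hn (Y 0 ω)) hf hK).trans_lt ?_
  rw [← mul_div_assoc, div_lt_iff₀ (by positivity)]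
  nlinarith

/-- Weighted sums of a centred bounded function along a uniformly ergodic chain converge. -/
theorem IsMarkovChain.ae_exists_tendsto_sum (hY : IsMarkovChain P κ Y)
    (hκ : IsUniformlyErgodic κ μ) {f : S → ℝ} {K : ℝ} (hf : Measurable f) (hK : ∀ x, |f x| ≤ K)
    {c : ℕ → ℝ} (hanti : Antitone c) (hc0 : Tendsto c atTop (𝓝 0))
    (hc : Summable fun n => c n ^ 2) :
    ∀ᵐ ω ∂P, ∃ L, Tendsto (fun n => ∑ i ∈ Finset.range n, c i * (f (Y i ω) - ∫ x, f x ∂μ))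
      atTop (𝓝 L) := by
  obtain ⟨g, C, hg, hgC, hpoisson⟩ := hκ.exists_poisson hf hK
  have hTg := measurable_integral_kernel (κ := κ) hg
  -- By the Poisson equation, f(Y_i) - μ(f) = (g(Y_{i+1}) - κg(Y_i)) + (g(Y_i) - g(Y_{i+1})). The
  -- first bracket is a martingale difference.
  have hmart := ae_exists_tendsto_sum_of_condExp_eq_zero (P := P) (ℱ := hY.filtration)
    (D := fun n ω => g (Y (n + 1) ω) - ∫ y, g y ∂κ (Y n ω)) (K := 2 * C) (c := c)
    (fun n => (hg.comp (hY.measurable_filtration le_rfl)).sub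
      (hTg.comp (hY.measurable_filtration (Nat.le_succ n))))
    (fun n => ae_of_all _ fun ω => (abs_sub _ _).trans (by
      have := hgC (Y (n + 1) ω)
      have := abs_integral_le_of_abs_le (ν := κ (Y n ω)) hgC
      linarith))
    (fun n => by
      have hTm : Measurable[hY.filtration n] fun ω => ∫ y, g y ∂κ (Y n ω) :=
        hTg.comp (hY.measurable_filtration le_rfl)
      have hi : Integrable (fun ω => ∫ y, g y ∂κ (Y n ω)) P :=
        integrable_of_measurable_of_abs_le (hTm.mono (hY.filtration.le n) le_rfl)
          fun ω => abs_integral_le_of_abs_le hgC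
      have h1 := condExp_sub (m := hY.filtration n) (μ := P)
        (f := fun ω => g (Y (n + 1) ω)) (g := fun ω => ∫ y, g y ∂κ (Y n ω))
        (integrable_of_measurable_of_abs_le (hg.comp (hY.1 _)) fun ω => hgC _) hi
      rw [condExp_of_stronglyMeasurable (hY.filtration.le n) hTm.stronglyMeasurable hi] at h1
      refine h1.trans ?_
      filter_upwards [hY.condExp_comp hg hgC n] with ω hω
      simp [hω]) hc
  filter_upwards [hmart] with ω ⟨L₁, hL₁⟩
  -- The second bracket has bounded partial sums, so Dirichlet's test applies with the monotone
  -- weights `c`.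
  have htel : CauchySeq fun n => ∑ i ∈ Finset.range n, c i • (g (Y i ω) - g (Y (i + 1) ω)) := by
    refine hanti.cauchySeq_series_mul_of_tendsto_zero_of_bounded hc0 (b := 2 * C) fun n => ?_
    rw [Finset.sum_range_sub' (fun i => g (Y i ω))]
    refine (norm_sub_le _ _).trans ?_
    have h1 := hgC (Y 0 ω)
    have h2 := hgC (Y n ω)
    rw [Real.norm_eq_abs, Real.norm_eq_abs]
    linarith
  obtain ⟨L₂, hL₂⟩ := cauchySeq_tendsto_of_complete htel
  refine ⟨L₁ + L₂, (hL₁.add hL₂).congr fun n => ?_⟩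
  rw [← Finset.sum_add_distrib]
  refine Finset.sum_congr rfl fun i _ => ?_
  rw [← hpoisson, smul_eq_mul]
  ring

end Chain

/-! ### Independent multipliers and the noise tails -/

/-- Factorisation is checked on the π-system of intersections s ∩ t, which generates m₂ ⊔ m₃: first
split off s, then separate v from t. It makes the current weight independent of the chain and the
earlier weights jointly. -/
theorem indep_sup_right {Ω : Type*} {m₁ m₂ m₃ mΩ : MeasurableSpace Ω} {P : Measure Ω}
    [IsProbabilityMeasure P] (h₁ : m₁ ≤ mΩ) (h₂ : m₂ ≤ mΩ) (h₃ : m₃ ≤ mΩ)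
    (h13 : Indep m₁ m₃ P) (h2 : Indep (m₁ ⊔ m₃) m₂ P) : Indep m₁ (m₂ ⊔ m₃) P := by
  set p : Set (Set Ω) :=
    {u | ∃ s t, MeasurableSet[m₂] s ∧ MeasurableSet[m₃] t ∧ u = s ∩ t} with hp
  have hgen : m₂ ⊔ m₃ = MeasurableSpace.generateFrom p := by
    refine le_antisymm (sup_le ?_ ?_) (MeasurableSpace.generateFrom_le ?_)
    · exact fun s hs => MeasurableSpace.measurableSet_generateFrom
        ⟨s, Set.univ, hs, MeasurableSet.univ, (Set.inter_univ s).symm⟩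
    · exact fun s hs => MeasurableSpace.measurableSet_generateFrom
        ⟨Set.univ, s, MeasurableSet.univ, hs, (Set.univ_inter s).symm⟩
    · rintro _ ⟨s, t, hs, ht, rfl⟩
      exact MeasurableSet.inter ((le_sup_left : m₂ ≤ m₂ ⊔ m₃) s hs)
        ((le_sup_right : m₃ ≤ m₂ ⊔ m₃) t ht)
  have hpi : IsPiSystem p := by
    rintro _ ⟨s, t, hs, ht, rfl⟩ _ ⟨s', t', hs', ht', rfl⟩ _
    exact ⟨s ∩ s', t ∩ t', hs.inter hs', ht.inter ht', Set.inter_inter_inter_comm s t s' t'⟩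
  refine IndepSets.indep (p1 := {s | MeasurableSet[m₁] s}) (p2 := p) h₁ (sup_le h₂ h₃)
    (@MeasurableSpace.isPiSystem_measurableSet Ω m₁) hpi
    (@MeasurableSpace.generateFrom_measurableSet Ω m₁).symm hgen ?_
  rw [IndepSets_iff]
  rintro v _ hv ⟨s, t, hs, ht, rfl⟩
  rw [Indep_iff] at h13 h2
  have hv' : MeasurableSet[m₁] v := hv
  have e1 := h2 (v ∩ t) s (MeasurableSet.inter ((le_sup_left : m₁ ≤ m₁ ⊔ m₃) v hv')
        ((le_sup_right : m₃ ≤ m₁ ⊔ m₃) t ht)) hs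
  have e2 := h13 v t hv' ht
  have e3 := h2 t s ((le_sup_right : m₃ ≤ m₁ ⊔ m₃) t ht) hs
  rw [Set.inter_comm s t, e3, ← Set.inter_assoc, e1, e2, mul_assoc]

/-- Series with bounded centred independent multipliers `Vᵢ` that are independent of the bounded
summands `f (Yᵢ)` converge almost surely for square summable weights. -/
theorem ae_exists_tendsto_sum_indep {Ω S : Type*} [mΩ : MeasurableSpace Ω] [MeasurableSpace S]
    {P : Measure Ω} [IsProbabilityMeasure P] {Y : ℕ → Ω → S} {V : ℕ → Ω → ℝ}
    (hY : ∀ n, Measurable (Y n)) (hV : ∀ n, Measurable (V n)) (hVindep : iIndepFun V P)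
    (hVY : IndepFun (fun ω n => V n ω) (fun ω n => Y n ω) P) {B : ℝ}
    (hVB : ∀ n, ∀ᵐ ω ∂P, |V n ω| ≤ B) (hV1 : ∀ n, ∫ ω, V n ω ∂P = 1)
    {f : S → ℝ} {K : ℝ} (hf : Measurable f) (hK : ∀ x, |f x| ≤ K)
    {c : ℕ → ℝ} (hc : Summable fun n => c n ^ 2) :
    ∀ᵐ ω ∂P, ∃ L, Tendsto (fun n => ∑ i ∈ Finset.range n, c i * ((V i ω - 1) * f (Y i ω)))
      atTop (𝓝 L) := by
  have hYle : MeasurableSpace.comap (fun ω n => Y n ω) inferInstance ≤ mΩ :=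
    (measurable_pi_lambda _ hY).comap_le
  have hVle : ∀ i, MeasurableSpace.comap (V i) inferInstance ≤ mΩ := fun i => (hV i).comap_le
  let past : ℕ → MeasurableSpace Ω := fun n =>
    ⨆ i ∈ Set.Iio n, MeasurableSpace.comap (V i) inferInstance
  have hpast : ∀ n, past n ≤ mΩ := fun n => iSup₂_le fun i _ => hVle i
  -- The entire trajectory of Y is known at time 0, and at time n only the weights with index < n.
  -- So f(Y_n) is ℱ_n-measurable while V_n is independent of ℱ_n.
  let ℱ : Filtration ℕ mΩ :=
    { seq := fun n => MeasurableSpace.comap (fun ω n => Y n ω) inferInstance ⊔ past n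
      mono' := fun m n hmn => sup_le_sup_left
        (biSup_mono fun i hi => lt_of_lt_of_le hi hmn) _
      le' := fun n => sup_le hYle (hpast n) }
  have hYm : ∀ i n, Measurable[ℱ n] (Y i) := fun i n => by
    have h1 : Measurable[MeasurableSpace.comap (fun ω n => Y n ω) inferInstance]
      (fun ω n => Y n ω) := comap_measurable _
    have h2 : MeasurableSpace.comap (fun ω n => Y n ω) inferInstance ≤ ℱ n := le_sup_left
    exact ((measurable_pi_apply i).comp h1).mono h2 le_rfl
  have hVm : ∀ n, Measurable[ℱ (n + 1)] (V n) := fun n => by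
    have h1 : MeasurableSpace.comap (V n) inferInstance ≤ past (n + 1) :=
      le_iSup₂_of_le (f := fun i (_ : i ∈ Set.Iio (n + 1)) =>
        MeasurableSpace.comap (V i) inferInstance) n (Nat.lt_succ_self n) le_rfl
    exact (comap_measurable (V n)).mono (h1.trans (le_sup_right : past (n + 1) ≤ ℱ (n + 1))) le_rfl
  have hindep : ∀ n, Indep (MeasurableSpace.comap (V n) inferInstance) (ℱ n) P := by
    intro n
    refine indep_sup_right (hVle n) hYle (hpast n) ?_ ?_
    · have h1 := indep_iSup_of_disjoint (S := {n}) (T := Set.Iio n) hVle hVindep (by simp)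
      rwa [iSup_singleton] at h1
    · have h1 : ∀ i, MeasurableSpace.comap (V i) inferInstance
          ≤ MeasurableSpace.comap (fun ω n => V n ω) inferInstance := by
        intro i
        have h2 : Measurable[MeasurableSpace.comap (fun ω n => V n ω) inferInstance]
          (fun ω n => V n ω) := comap_measurable _
        exact ((measurable_pi_apply i).comp h2).comap_le
      exact indep_of_indep_of_le_left hVY (sup_le (h1 n) (iSup₂_le fun i _ => h1 i))
  refine ae_exists_tendsto_sum_of_condExp_eq_zero (ℱ := ℱ)
    (D := fun n ω => (V n ω - 1) * f (Y n ω)) (K := (B + 1) * K)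
    (fun n => ((hVm n).sub_const 1).mul (hf.comp (hYm n _))) (fun n => ?_) (fun n => ?_) hc
  · filter_upwards [hVB n] with ω hω
    rw [abs_mul]
    have h1 : |V n ω - 1| ≤ B + 1 := (abs_sub _ _).trans (by simpa using hω)
    exact mul_le_mul h1 (hK _) (abs_nonneg _) ((abs_nonneg _).trans h1)
  · have hVi : Integrable (V n) P := Integrable.of_bound (hV n).aestronglyMeasurable B (hVB n)
    have hVi' : Integrable (fun ω => V n ω - 1) P := hVi.sub (integrable_const 1)
    have h1 := condExp_stronglyMeasurable_mul_of_bound (μ := P) (ℱ.le n)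
      (f := fun ω => f (Y n ω)) (g := fun ω => V n ω - 1)
      (hf.comp (hYm n n)).stronglyMeasurable hVi' K (ae_of_all _ fun ω => hK _)
    have h2 := condExp_indep_eq (μ := P) (f := fun ω => V n ω - 1) (hVle n) (ℱ.le n)
      ((comap_measurable (V n)).sub_const 1).stronglyMeasurable (hindep n)
    have h3 : ∫ ω, (V n ω - 1) ∂P = 0 := by
      rw [integral_sub hVi (integrable_const 1), hV1]; simp
    have h4 : (fun ω => (V n ω - 1) * f (Y n ω)) = (fun ω => f (Y n ω)) * fun ω => V n ω - 1 := by
      ext ω; simp [mul_comm]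
    rw [h4]
    filter_upwards [h1, h2] with ω h5 h6
    rw [h5, Pi.mul_apply, h6, h3]
    simp

/-- Step-size weighted sums of `Wₜ f(Xₜ) - μ(f)` converge almost surely, with tails `o(t ^ (-γ))`. -/
theorem IsMarkovChain.ae_exists_tail_isLittleO {Ω S : Type*} [MeasurableSpace Ω]
    [MeasurableSpace S] {P : Measure Ω} [IsProbabilityMeasure P] {κ : Kernel S S} [IsMarkovKernel κ]
    {μ : Measure S} [IsProbabilityMeasure μ] {Y : ℕ → Ω → S} {V : ℕ → Ω → ℝ}
    (hY : IsMarkovChain P κ Y) (hκ : IsUniformlyErgodic κ μ)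
    (hV : ∀ n, Measurable (V n)) (hVindep : iIndepFun V P)
    (hVY : IndepFun (fun ω n => V n ω) (fun ω n => Y n ω) P) {B : ℝ}
    (hVB : ∀ n, ∀ᵐ ω ∂P, |V n ω| ≤ B) (hV1 : ∀ n, ∫ ω, V n ω ∂P = 1)
    {f : S → ℝ} {K : ℝ} (hf : Measurable f) (hK : ∀ x, |f x| ≤ K)
    {α₀ η γ : ℝ} (hα₀ : 0 < α₀) (hγ0 : 0 < γ) (hγ : γ < η - 1 / 2) :
    ∀ᵐ ω ∂P, ∃ L, (fun n => L - ∑ i ∈ Finset.range n,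
        stepSize α₀ η (i + 1) * (V i ω * f (Y i ω) - ∫ x, f x ∂μ))
      =o[atTop] fun n : ℕ => ((n + 1 : ℕ) : ℝ) ^ (-γ) := by
  have hs : 0 < η - γ := by linarith
  -- The step size divided by the target rate (n+1)^(-γ); the exponent η - γ exceeds 1/2, which is
  -- what square summability requires.
  set c : ℕ → ℝ := fun n => α₀ * ((n + 1 : ℕ) : ℝ) ^ (-(η - γ)) with hc
  have hcs : Summable fun n => c n ^ 2 := summable_sq_mul_succ_rpow_neg α₀ (by linarith)
  have hanti : Antitone c := fun m n hmn =>
    mul_le_mul_of_nonneg_left (antitone_succ_rpow_neg (by linarith) hmn) hα₀.le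
  have hc0 : Tendsto c atTop (𝓝 0) := by
    have h := (tendsto_succ_rpow_neg hs).const_mul α₀
    rwa [mul_zero] at h
  filter_upwards [hY.ae_exists_tendsto_sum hκ hf hK hanti hc0 hcs,
    ae_exists_tendsto_sum_indep hY.1 hV hVindep hVY hVB hV1 hf hK hcs] with ω ⟨L₁, h₁⟩ ⟨L₂, h₂⟩
  obtain ⟨L, hL⟩ := exists_tail_isLittleO (p := fun n : ℕ => ((n + 1 : ℕ) : ℝ) ^ (-γ))
    (x := fun n => c n * (V n ω * f (Y n ω) - ∫ x, f x ∂μ)) (fun n => by positivity)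
    (antitone_succ_rpow_neg hγ0.le) ⟨L₁ + L₂, (h₁.add h₂).congr fun n => by
      rw [← Finset.sum_add_distrib]
      exact Finset.sum_congr rfl fun i _ => by ring⟩
  refine ⟨L, hL.congr_left fun n => ?_⟩
  congr 1
  refine Finset.sum_congr rfl fun i _ => ?_
  have h3 : ((i + 1 : ℕ) : ℝ) ^ (-γ) * c i = stepSize α₀ η (i + 1) := by
    rw [stepSize_succ_eq, hc]
    simp only
    rw [mul_left_comm, ← Real.rpow_add (by positivity)]
    congr 2
    ring
  rw [← h3]; ring

/-! ### From entrywise to operator bounds, and assembly -/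

theorem norm_toEuclideanCLM_le {d : ℕ} (B : Matrix (Fin d) (Fin d) ℝ) :
    ‖Matrix.toEuclideanCLM (n := Fin d) (𝕜 := ℝ) B‖
      ≤ ∑ i, ∑ j, ‖Matrix.toEuclideanCLM (n := Fin d) (𝕜 := ℝ) (Matrix.single i j 1)‖ * |B i j| := by
  have h : Matrix.toEuclideanCLM (n := Fin d) (𝕜 := ℝ) B
      = ∑ i, ∑ j, B i j • Matrix.toEuclideanCLM (n := Fin d) (𝕜 := ℝ) (Matrix.single i j 1) := by
    conv_lhs => rw [Matrix.matrix_eq_sum_single B]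
    simp_rw [map_sum, ← map_smul, Matrix.smul_single, smul_eq_mul, mul_one]
  rw [h]
  refine (norm_sum_le _ _).trans (Finset.sum_le_sum fun i _ => (norm_sum_le _ _).trans
    (Finset.sum_le_sum fun j _ => ?_))
  rw [norm_smul, mul_comm, Real.norm_eq_abs]

theorem abs_apply_le_frobenius_norm {d : ℕ} (B : Matrix (Fin d) (Fin d) ℝ) (i j : Fin d) :
    |B i j| ≤ ‖B‖ := by
  rw [Matrix.frobenius_norm_def, ← Real.sqrt_eq_rpow]
  refine Real.le_sqrt_of_sq_le ?_
  have h1 := Finset.single_le_sum (f := fun j => ‖B i j‖ ^ (2 : ℝ)) (s := Finset.univ)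
    (fun j _ => by positivity) (Finset.mem_univ j)
  have h2 := Finset.single_le_sum (f := fun i => ∑ j, ‖B i j‖ ^ (2 : ℝ)) (s := Finset.univ)
    (fun i _ => by positivity) (Finset.mem_univ i)
  refine le_trans (le_of_eq ?_) (h1.trans h2)
  rw [Real.norm_eq_abs]
  norm_cast

theorem isLittleO_toEuclideanCLM {d : ℕ} {r : ℕ → Matrix (Fin d) (Fin d) ℝ} {p : ℕ → ℝ}
    (h : ∀ i j, (fun n => r n i j) =o[atTop] p) :
    (fun n => Matrix.toEuclideanCLM (n := Fin d) (𝕜 := ℝ) (r n)) =o[atTop] p := by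
  have h1 : (fun n => ∑ i, ∑ j,
      ‖Matrix.toEuclideanCLM (n := Fin d) (𝕜 := ℝ) (Matrix.single i j 1)‖ * |r n i j|)
      =o[atTop] p :=
    IsLittleO.fun_sum fun i _ => IsLittleO.fun_sum fun j _ => (h i j).norm_left.const_mul_left _
  refine IsBigO.trans_isLittleO (IsBigO.of_bound 1 (Eventually.of_forall fun n => ?_)) h1
  rw [one_mul]
  exact (norm_toEuclideanCLM_le _).trans (le_abs_self _)

theorem isLittleO_toLp {d : ℕ} {r : ℕ → Fin d → ℝ} {p : ℕ → ℝ}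
    (h : ∀ i, (fun n => r n i) =o[atTop] p) :
    (fun n => WithLp.toLp 2 (r n) : ℕ → EuclideanSpace ℝ (Fin d)) =o[atTop] p := by
  have h1 : (fun n => ∑ i, |r n i|) =o[atTop] p := IsLittleO.fun_sum fun i _ => (h i).norm_left
  refine IsBigO.trans_isLittleO (IsBigO.of_bound 1 (Eventually.of_forall fun n => ?_)) h1
  rw [one_mul, Real.norm_of_nonneg (Finset.sum_nonneg fun i _ => abs_nonneg _)]
  rw [← (EuclideanSpace.basisFun (Fin d) ℝ).sum_repr (WithLp.toLp 2 (r n))]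
  refine (norm_sum_le _ _).trans (Finset.sum_le_sum fun i _ => ?_)
  rw [norm_smul]
  simp

/-- The convergence rate of the perturbed iterates along one trajectory, from the rates of the
entrywise noise series. -/
theorem perturbedIterate_sub_isLittleO {S : Type*} {d : ℕ}
    {A : S → Matrix (Fin d) (Fin d) ℝ} {b : S → EuclideanSpace ℝ (Fin d)}
    {Abar : Matrix (Fin d) (Fin d) ℝ} {bbar θstar : EuclideanSpace ℝ (Fin d)}
    (hHurwitz : IsHurwitz Abar) (hθstar : Matrix.toEuclideanLin Abar θstar = bbar)
    {Amax bmax B : ℝ} (hAmax : ∀ x, ‖A x‖ ≤ Amax) (hbmax : ∀ x, ‖b x‖ ≤ bmax)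
    {α₀ η γ : ℝ} (hα₀ : 0 < α₀) (hη0 : 0 < η) (hη1 : η < 1) (hγ0 : 0 < γ) (hγ1 : γ ≤ 1)
    {x : ℕ → S} {w : ℕ → ℝ} (hw : ∀ n, |w (n + 1)| ≤ B)
    (hA : ∀ i j, ∃ L, (fun n => L - ∑ k ∈ Finset.range n,
        stepSize α₀ η (k + 1) * (w (k + 1) * A (x (k + 1)) i j - Abar i j))
      =o[atTop] fun n : ℕ => ((n + 1 : ℕ) : ℝ) ^ (-γ))
    (hb : ∀ i, ∃ L, (fun n => L - ∑ k ∈ Finset.range n,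
        stepSize α₀ η (k + 1) * (w (k + 1) * b (x (k + 1)) i - bbar i))
      =o[atTop] fun n : ℕ => ((n + 1 : ℕ) : ℝ) ^ (-γ))
    (θ₀ : EuclideanSpace ℝ (Fin d)) :
    (fun n => perturbedIterate A b (stepSize α₀ η) x w θ₀ n - θstar)
      =o[atTop] fun n : ℕ => ((n + 1 : ℕ) : ℝ) ^ (-γ) := by
  choose LA hLA using hA
  choose Lb hLb using hb
  obtain ⟨q, C, c, δ₀, hC, hc, hδ₀, hq1, hq2, hq⟩ := hHurwitz.exists_seminorm_contraction
  set Φ := Matrix.toEuclideanCLM (n := Fin d) (𝕜 := ℝ) with hΦ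
  have hΦlin : ∀ (G : Matrix (Fin d) (Fin d) ℝ) v, Matrix.toEuclideanLin G v = Φ G v :=
    fun _ _ => rfl
  set a : ℕ → ℝ := fun n => stepSize α₀ η (n + 1) with ha
  set r : ℕ → Matrix (Fin d) (Fin d) ℝ := fun n => Matrix.of fun i j =>
    LA i j - ∑ k ∈ Finset.range n, a k * (w (k + 1) * A (x (k + 1)) i j - Abar i j) with hr
  set Q : ℕ → EuclideanSpace ℝ (Fin d) := fun n => WithLp.toLp 2 fun i =>
    Lb i - ∑ k ∈ Finset.range n, a k * (w (k + 1) * b (x (k + 1)) i - bbar i) with hQ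
  set M : ℕ → EuclideanSpace ℝ (Fin d) →L[ℝ] EuclideanSpace ℝ (Fin d) := fun n =>
    w (n + 1) • Φ (A (x (n + 1))) with hM
  set ξ : ℕ → EuclideanSpace ℝ (Fin d) := fun n =>
    M n θstar - w (n + 1) • b (x (n + 1)) with hξ
  have hrp : (fun n => Φ (r n)) =o[atTop] fun n : ℕ => ((n + 1 : ℕ) : ℝ) ^ (-γ) :=
    isLittleO_toEuclideanCLM hLA
  have hQp : Q =o[atTop] fun n : ℕ => ((n + 1 : ℕ) : ℝ) ^ (-γ) := isLittleO_toLp hLb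
  have hB0 : 0 ≤ B := (abs_nonneg _).trans (hw 0)
  set K₁ : ℝ := B * ∑ i, ∑ j, ‖Φ (Matrix.single i j 1)‖ * Amax with hK₁
  have hMK : ∀ n, ‖M n‖ ≤ K₁ := by
    intro n
    rw [hM, hK₁]
    simp only
    rw [norm_smul]
    refine mul_le_mul (hw n) ((norm_toEuclideanCLM_le _).trans ?_) (norm_nonneg _) hB0
    gcongr
    exact (abs_apply_le_frobenius_norm _ _ _).trans (hAmax _)
  have hξK : ∀ n, ‖ξ n‖ ≤ K₁ * ‖θstar‖ + B * bmax := by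
    intro n
    refine (norm_sub_le _ _).trans (add_le_add (((M n).le_opNorm _).trans ?_) ?_)
    · gcongr; exact hMK n
    · rw [norm_smul]
      exact mul_le_mul (hw n) (hbmax _) (norm_nonneg _) hB0
  have hR : ∀ n, Φ (r n) - Φ (r (n + 1)) = a n • (M n - Φ Abar) := by
    intro n
    have h1 : r n - r (n + 1) = a n • (w (n + 1) • A (x (n + 1)) - Abar) := by
      ext i j
      simp [hr, Finset.sum_range_succ]
    rw [← map_sub, h1, map_smul, map_sub, map_smul]
  have hQd : ∀ n, Q n - Q (n + 1) = a n • (w (n + 1) • b (x (n + 1)) - bbar) := by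
    intro n
    ext i
    simp [hQ, Finset.sum_range_succ]
  -- The noise at θ* is ξ = w (A θ* - b); since Ā θ* = b̄, its tail is the matrix tail applied to θ*
  -- minus the vector tail `Q`.
  refine isLittleO_of_linear_recursion (M := M) (ξ := ξ) (R := fun n => Φ (r n))
    (Z := fun n => Φ (r n) θstar - Q n) (T := Φ Abar) (a := a)
    (δ := fun n : ℕ => 1 / ((n + 1 : ℕ) : ℝ)) (K := max K₁ (K₁ * ‖θstar‖ + B * bmax))
    (fun n => ?_) (fun n => (hMK n).trans (le_max_left _ _))
    (fun n => (hξK n).trans (le_max_right _ _)) hR (fun n => ?_) hrp ?_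
    (fun n => stepSize_succ_pos hα₀ n) (tendsto_stepSize_succ α₀ hη0)
    (tendsto_sum_stepSize_succ hα₀ hη1.le) (fun n => by positivity) (fun n => by positivity)
    (isLittleO_one_div_succ_stepSize hα₀ hη1) (fun n => succ_rpow_neg_le hγ1 n)
    (antitone_succ_rpow_neg hγ0.le) q hC hc hδ₀ hq1 hq2 hq
  · simp only [perturbedIterate, hΦlin, hξ, hM, ha, smul_apply, map_sub, smul_sub, smul_add,
      mul_smul]
    abel
  · have h1 := congrArg (fun G : EuclideanSpace ℝ (Fin d) →L[ℝ] EuclideanSpace ℝ (Fin d) =>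
      G θstar) (hR n)
    simp only [sub_apply, smul_apply] at h1
    rw [hΦlin] at hθstar
    rw [sub_sub_sub_comm, h1, hQd, hθstar, ← smul_sub, hξ]
    congr 1
    simp only
    abel
  · refine IsLittleO.sub ?_ hQp
    refine IsBigO.trans_isLittleO (IsBigO.of_bound ‖θstar‖ (Eventually.of_forall fun n => ?_)) hrp
    rw [mul_comm]
    exact (Φ (r n)).le_opNorm _

theorem proposition3
    {Ω S : Type*} [MeasurableSpace Ω] [MeasurableSpace S]
    (P : Measure Ω) [IsProbabilityMeasure P] {d : ℕ}
    -- the Markov chain `X 1, X 2, …`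
    (κ : Kernel S S) [IsMarkovKernel κ] (μ : Measure S) [IsProbabilityMeasure μ]
    (X : ℕ → Ω → S)
    (hX : IsMarkovChain P κ (fun t => X (t + 1)))
    (hκ : IsUniformlyErgodic κ μ)
    -- the observations: limiting means, stability, boundedness
    (A : S → Matrix (Fin d) (Fin d) ℝ) (b : S → EuclideanSpace ℝ (Fin d))
    (hAmeas : ∀ i j, Measurable fun x => A x i j) (hbmeas : Measurable b)
    (Abar : Matrix (Fin d) (Fin d) ℝ) (bbar : EuclideanSpace ℝ (Fin d))
    (hAlim : ∀ i j, Tendsto (fun t => ∫ ω, A (X t ω) i j ∂P) atTop (𝓝 (Abar i j)))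
    (hblim : Tendsto (fun t => ∫ ω, b (X t ω) ∂P) atTop (𝓝 bbar))
    (hrank : Abar.rank = d) (hHurwitz : IsHurwitz Abar)
    (Amax bmax : ℝ) (hAmax : ∀ x, ‖A x‖ ≤ Amax) (hbmax : ∀ x, ‖b x‖ ≤ bmax)
    -- the step sizes `α_t = α₀ / t ^ η`
    (α₀ η : ℝ) (hα₀ : 0 < α₀) (hη : η ∈ Set.Ioo (1 / 2 : ℝ) 1)
    -- the i.i.d. bounded weights `W 1, W 2, …`, independent of the chain
    (W : ℕ → Ω → ℝ) (hWmeas : ∀ t, Measurable (W (t + 1)))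
    (hWindep : iIndepFun (fun t => W (t + 1)) P)
    (hWident : ∀ t, IdentDistrib (W (t + 1)) (W 1) P P)
    (hWmean : ∫ ω, W 1 ω ∂P = 1) (hWvar : variance (W 1) P = 1)
    (Wmax : ℝ) (hWmax : ∀ᵐ ω ∂P, |W 1 ω| ≤ Wmax)
    (hWX : IndepFun (fun ω t => W (t + 1) ω) (fun ω t => X (t + 1) ω) P)
    -- the target and the initial value
    (θstar : EuclideanSpace ℝ (Fin d)) (hθstar : Matrix.toEuclideanLin Abar θstar = bbar)
    (θ₀ : Ω → EuclideanSpace ℝ (Fin d))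
    (γ : ℝ) (hγ : γ ∈ Set.Ioo 0 (η - 1 / 2)) :
    ∀ᵐ ω ∂P,
      (fun t : ℕ =>
        ‖perturbedIterate A b (stepSize α₀ η) (fun t => X t ω) (fun t => W t ω) (θ₀ ω) t - θstar‖)
        =o[atTop] fun t : ℕ => (t : ℝ) ^ (-γ) := by
  have hη0 : 0 < η := by linarith [hη.1]
  have hγ1 : γ ≤ 1 := by linarith [hγ.2, hη.2]
  have hWB : ∀ n, ∀ᵐ ω ∂P, |W (n + 1) ω| ≤ Wmax := fun n =>
    (hWident n).symm.ae_snd (p := fun y => |y| ≤ Wmax)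
      (measurableSet_le measurable_id.abs measurable_const) hWmax
  have hW1 : ∀ n, ∫ ω, W (n + 1) ω ∂P = 1 := fun n => (hWident n).integral_eq.trans hWmean
  have hAK : ∀ i j x, |A x i j| ≤ Amax := fun i j x =>
    (abs_apply_le_frobenius_norm _ _ _).trans (hAmax x)
  have hbK : ∀ i x, |b x i| ≤ bmax := fun i x => (PiLp.norm_apply_le (b x) i).trans (hbmax x)
  have hbm : ∀ i, Measurable fun x => b x i := fun i =>
    (EuclideanSpace.proj (𝕜 := ℝ) i).continuous.measurable.comp hbmeas
  -- The limit of the means is unique, so Ā and b̄ are the stationary averages about which the noise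
  -- series are centred. The chain `X (t + 1)` is indexed from 0, hence the shift.
  have hAeq : ∀ i j, ∫ x, A x i j ∂μ = Abar i j := fun i j =>
    tendsto_nhds_unique (hX.tendsto_integral hκ (hAmeas i j) (hAK i j))
      ((hAlim i j).comp (tendsto_add_atTop_nat 1))
  have hbeq : ∀ i, ∫ x, b x i ∂μ = bbar i := fun i => by
    refine tendsto_nhds_unique (hX.tendsto_integral hκ (hbm i) (hbK i)) ?_
    have h1 := ((EuclideanSpace.proj (𝕜 := ℝ) i).continuous.tendsto bbar).comp
      (hblim.comp (tendsto_add_atTop_nat 1))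
    refine h1.congr fun n => ?_
    have h2 : Integrable (fun ω => b (X (n + 1) ω)) P :=
      Integrable.of_bound (hbmeas.comp (hX.1 n)).aestronglyMeasurable bmax
        (ae_of_all _ fun ω => hbmax _)
    exact ((EuclideanSpace.proj (𝕜 := ℝ) i).integral_comp_comm h2).symm
  have hAe := fun i j => hX.ae_exists_tail_isLittleO hκ hWmeas hWindep hWX hWB hW1 (hAmeas i j)
    (hAK i j) hα₀ hγ.1 hγ.2
  have hbe := fun i => hX.ae_exists_tail_isLittleO hκ hWmeas hWindep hWX hWB hW1 (hbm i)
    (hbK i) hα₀ hγ.1 hγ.2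
  simp_rw [hAeq] at hAe
  simp_rw [hbeq] at hbe
  filter_upwards [ae_all_iff.2 fun i => ae_all_iff.2 (hAe i), ae_all_iff.2 hbe,
    ae_all_iff.2 hWB] with ω h1 h2 h3
  have h4 := perturbedIterate_sub_isLittleO hHurwitz hθstar hAmax hbmax hα₀ hη0 hη.2 hγ.1
    hγ1 (x := fun t => X t ω) (w := fun t => W t ω) h3 h1 h2 (θ₀ ω)
  -- Passing from (n+1)^(-γ) to n^(-γ) only enlarges the rate for n > 0.
  refine h4.norm_left.trans_isBigO (IsBigO.of_bound 1 ?_)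
  filter_upwards [eventually_gt_atTop 0] with n hn
  have hn' : (0 : ℝ) < n := by exact_mod_cast hn
  rw [one_mul, Real.norm_of_nonneg (by positivity), Real.norm_of_nonneg (by positivity)]
  exact Real.rpow_le_rpow_of_nonpos hn' (by push_cast; linarith) (by linarith [hγ.1])
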